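/- Let $V$ be a finite-dimensional complex Hilbert space. For $s\in\mathbb R$ let $H(s)$ be Hermitian operators and $L_\mu(s)$ (with $\mu$ in a finite index set) arbitrary operators on $V$, and let $$\hat{\mathcal L}'(s)[\rho] = -\mathrm i[H(s),\rho]+\sum_\mu\bigl(2L_\mu(s)\rho L_\mu(s)^\dagger-\{L_\mu(s)^\dagger L_\mu(s),\rho\}\bigr)$$ be the corresponding Liouvillian acting on the operators on $V$. Assume that $s\mapsto\hat{\mathcal L}'(s)$ is analytic at $s=0$ and that, as $s\to0$, $$H(s)=H^{(0)}+sH^{(1)}+\mathcal O(s^2),\qquad L_\mu(s)=L_\mu^{(0)}+\mathcal O(s^2)\ \text{ for all }\mu .$$ Let $\omega\in\mathbb R$ be such that $\mathrm i\omega$ is an eigenvalue of $\hat{\mathcal L}'(0)$, and let $m$ be the dimension of its eigenspace. Then the first-order term of $\hat{\mathcal L}'(s)$ at $s=0$ is $-\mathrm i[H^{(1)},\cdot\,]$, and there are $r,\varepsilon>0$ and functions $\lambda_1,\dots,\lambda_m:(-\varepsilon,\varepsilon)\to\mathbb C$ such that for every $s\in(-\varepsilon,\varepsilon)$ the eigenvalues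 of $\hat{\mathcal L}'(s)$ in the disc $|z-\mathrm i\omega|<r$, counted with algebraic multiplicity, are exactly $\lambda_1(s),\dots,\lambda_m(s)$. Moreover each $\lambda_j$ is twice continuously differentiable on $(-\varepsilon,\varepsilon)$ and satisfies $$\lambda_j(s)=\mathrm i\omega+\mathrm i\,\lambda_{j}^{(1)}s+\lambda_{j}^{(2)}s^{2}+o(s^{2})\qquad(s\to0)$$ for some $\lambda_j^{(1)}\in\mathbb R$ and $\lambda_j^{(2)}\in\mathbb C$ with $\operatorname{Re}\lambda_j^{(2)}\le0$; that is, the expansion $\mathrm i\omega+\mathrm i\lambda^{(1)}s+\lambda^{(2)}s^{1+1/p}+o(s^{1+1/p})$ of perturbed purely imaginary eigenvalues holds with $p=1$. -/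

import Mathlib

open Filter Topology Asymptotics

/-- The operators on a (finite-dimensional) complex Hilbert space `V`. -/
abbrev Op (V : Type*) [NormedAddCommGroup V] [InnerProductSpace ℂ V] : Type _ := V →L[ℂ] V

/-- Super-operators: linear maps on the space of operators on `V`. -/
abbrev SuperOp (V : Type*) [NormedAddCommGroup V] [InnerProductSpace ℂ V] : Type _ :=
  Op V →L[ℂ] Op V

section

variable {V : Type*} [NormedAddCommGroup V] [InnerProductSpace ℂ V] [CompleteSpace V]
  [FiniteDimensional ℂ V]

/-- The super-operator `ρ ↦ -i [H, ρ]`. -/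
noncomputable def unitaryGenerator (H : Op V) : SuperOp V :=
  LinearMap.toContinuousLinearMap
    { toFun := fun ρ => (-Complex.I) • (H * ρ - ρ * H)
      map_add' := fun x y => by rw [mul_add, add_mul, ← smul_add]; congr 1; abel
      map_smul' := fun c x => by
        simp only [mul_smul_comm, smul_mul_assoc, ← smul_sub, RingHom.id_apply]
        rw [smul_comm] }

/-- The super-operator `ρ ↦ 2 L ρ L† - {L† L, ρ}` of one jump operator `L`. -/
noncomputable def jumpDissipator (L : Op V) : SuperOp V :=
  LinearMap.toContinuousLinearMap
    { toFun := fun ρ => (2 : ℂ) • (L * ρ * L.adjoint)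
        - ((L.adjoint * L) * ρ + ρ * (L.adjoint * L))
      map_add' := fun x y => by
        rw [mul_add, mul_add, add_mul, add_mul, smul_add]; abel
      map_smul' := fun c x => by
        simp only [mul_smul_comm, smul_mul_assoc, ← smul_add, RingHom.id_apply, smul_sub]
        rw [smul_comm] }

/-- The Liouvillian
`ρ ↦ -i [H, ρ] + ∑ μ, (2 L_μ ρ L_μ† - {L_μ† L_μ, ρ})`
with Hamiltonian `H` and jump operators `L_μ`. -/
noncomputable def liouvillian {ι : Type*} [Fintype ι] (H : Op V) (L : ι → Op V) : SuperOp V :=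
  unitaryGenerator H + ∑ μ, jumpDissipator (L μ)

theorem liouvillian_apply {ι : Type*} [Fintype ι] (H : Op V) (L : ι → Op V) (ρ : Op V) :
    liouvillian H L ρ = (-Complex.I) • (H * ρ - ρ * H)
      + ∑ μ, ((2 : ℂ) • (L μ * ρ * (L μ).adjoint)
          - (((L μ).adjoint * L μ) * ρ + ρ * ((L μ).adjoint * L μ))) := by
  simp [liouvillian, unitaryGenerator, jumpDissipator]

open Classical in
/-- The multiset of the eigenvalues of `T` in the open disc of centre `z₀` and radius `r`, each
repeated according to its algebraic multiplicity. -/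
noncomputable def eigenvaluesNear (T : SuperOp V) (z₀ : ℂ) (r : ℝ) : Multiset ℂ :=
  T.toLinearMap.charpoly.roots.filter (fun z => z ∈ Metric.ball z₀ r)

end

/-! A Lindblad generator is dissipative. In the Heisenberg picture `‖z • X - heisenbergGenerator H L
X‖ ≥ z.re * ‖X‖` in operator norm, and trace duality turns this into a resolvent bound `z.re * ‖ρ‖ ≤
C * ‖z • ρ - liouvillian H L ρ‖` for `0 < z.re`, with `C` depending on `V` alone
(`exists_forall_re_mul_norm_le_norm_smul_sub_liouvillian`). Everything spectral follows from this
uniform bound and analyticity.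

At `s = 0` the bound forbids Jordan blocks at `iω`, so algebraic and geometric multiplicities agree.
Let `P` be the projection onto the eigenspace along the range, and `D` the first-order term of the
family. Since the bound holds for both signs of `s`, the compression `P D P` inherits a resolvent
bound on both sides of the imaginary axis. It is therefore diagonalizable with imaginary eigenvalues
`iα`, and every eigenvalue near `iω` lies within `O(s²)` of some `iω + iαs`
(`exists_norm_eigenvalue_sub_le_sq`).

By Newton-Puiseux (`IsMonicAnalytic.hasPuiseuxRoots`) the eigenvalues are analytic functions of `τ`
with `τ ^ q = s`. The `O(s²)` estimate removes all fractional powers below `s²`, so a branch is `iω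
+ iαs + s² g(τ)` with `g` analytic. Such a function is `C²`, because each derivative in `s` costs
one power of `s`. As eigenvalues have nonpositive real part, `Re g(0) ≤ 0`. The formula for the
first derivative of the Liouvillian is the product rule, the dissipator being quadratic in the jump
operators. -/

/-! ### Dissipativity of the generators and the uniform resolvent bound -/

section Dissipative

variable {V : Type*} [NormedAddCommGroup V] [InnerProductSpace ℂ V] [CompleteSpace V]

/-- An operator on a nontrivial finite-dimensional space attains its norm on the unit sphere. -/
theorem exists_unit_norm_apply_eq_opNorm {V : Type*} [NormedAddCommGroup V]
    [InnerProductSpace ℂ V] [FiniteDimensional ℂ V] [Nontrivial V] (X : Op V) :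
    ∃ v : V, ‖v‖ = 1 ∧ ‖X v‖ = ‖X‖ := by
  have : ProperSpace V := FiniteDimensional.proper ℂ V
  obtain ⟨v, hv, hmax⟩ := (isCompact_sphere (0 : V) 1).exists_isMaxOn
    (by
      obtain ⟨x, hx⟩ := exists_ne (0 : V)
      refine ⟨((‖x‖⁻¹ : ℝ) : ℂ) • x, ?_⟩
      simp [norm_smul, inv_mul_cancel₀ (norm_ne_zero_iff.2 hx)])
    (f := fun v => ‖X v‖) (by fun_prop)
  have hv1 : ‖v‖ = 1 := by simpa using hv
  refine ⟨v, hv1, le_antisymm ?_ ?_⟩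
  · simpa [hv1] using X.le_opNorm v
  · refine X.opNorm_le_bound (norm_nonneg _) fun x => ?_
    rcases eq_or_ne x 0 with rfl | hx
    · simp
    · have hx' : ‖x‖ ≠ 0 := norm_ne_zero_iff.2 hx
      have h := hmax (show ((‖x‖⁻¹ : ℝ) : ℂ) • x ∈ Metric.sphere (0 : V) 1 by
        simp [norm_smul, inv_mul_cancel₀ hx'])
      simp only [map_smul, norm_smul, Set.mem_ofPred_eq] at h
      rw [Complex.norm_real, Real.norm_of_nonneg (by positivity)] at h
      rwa [inv_mul_le_iff₀ (by positivity), mul_comm] at h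

/-- Equality case of Cauchy-Schwarz: expanding the squared norm of the difference of the two sides
gives at most `‖X‖⁴ - 2‖X‖⁴ + ‖X‖⁴ = 0`. -/
theorem adjoint_apply_of_norm_apply_eq {X : Op V} {v : V} (hv : ‖v‖ = 1) (hX : ‖X v‖ = ‖X‖) :
    X.adjoint (X v) = ((‖X‖ ^ 2 : ℝ) : ℂ) • v := by
  have h1 : ‖X.adjoint (X v)‖ ≤ ‖X‖ ^ 2 := by
    have := X.adjoint.le_opNorm (X v)
    rw [LinearIsometryEquiv.norm_map, hX] at this
    nlinarith
  have h2 : RCLike.re (inner ℂ (X.adjoint (X v)) (((‖X‖ ^ 2 : ℝ) : ℂ) • v)) = ‖X‖ ^ 4 := by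
    rw [inner_smul_right, ContinuousLinearMap.adjoint_inner_left, inner_self_eq_norm_sq_to_K, hX]
    have : ((‖X‖ ^ 2 : ℝ) : ℂ) * ((‖X‖ : ℝ) : ℂ) ^ 2 = ((‖X‖ ^ 4 : ℝ) : ℂ) := by
      push_cast; ring
    exact (congrArg Complex.re this).trans (Complex.ofReal_re _)
  have h3 : ‖(((‖X‖ ^ 2 : ℝ) : ℂ) • v)‖ = ‖X‖ ^ 2 := by
    rw [norm_smul, hv, Complex.norm_real, Real.norm_of_nonneg (by positivity), mul_one]
  have h4 := norm_sub_sq (𝕜 := ℂ) (X.adjoint (X v)) (((‖X‖ ^ 2 : ℝ) : ℂ) • v)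
  rw [h2, h3] at h4
  have h5 : ‖X.adjoint (X v)‖ ^ 2 ≤ (‖X‖ ^ 2) ^ 2 := by gcongr
  have h6 : ‖X.adjoint (X v) - ((‖X‖ ^ 2 : ℝ) : ℂ) • v‖ ^ 2 ≤ 0 := by nlinarith
  have h7 : ‖X.adjoint (X v) - ((‖X‖ ^ 2 : ℝ) : ℂ) • v‖ = 0 := by
    nlinarith [norm_nonneg (X.adjoint (X v) - ((‖X‖ ^ 2 : ℝ) : ℂ) • v)]
  exact sub_eq_zero.1 (norm_eq_zero.1 h7)

/-- The generator of the Heisenberg-picture evolution dual to the Liouvillian. -/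
noncomputable def heisenbergGenerator {ι : Type*} [Fintype ι] (H : Op V) (L : ι → Op V) :
    Op V →ₗ[ℂ] Op V :=
  Complex.I • (LinearMap.mulLeft ℂ H - LinearMap.mulRight ℂ H)
    + ∑ μ, ((2 : ℂ) • (LinearMap.mulLeft ℂ (L μ).adjoint ∘ₗ LinearMap.mulRight ℂ (L μ))
      - (LinearMap.mulLeft ℂ ((L μ).adjoint * L μ) + LinearMap.mulRight ℂ ((L μ).adjoint * L μ)))

theorem heisenbergGenerator_apply {ι : Type*} [Fintype ι] (H : Op V) (L : ι → Op V) (X : Op V) :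
    heisenbergGenerator H L X = Complex.I • (H * X - X * H)
      + ∑ μ, ((2 : ℂ) • ((L μ).adjoint * (X * L μ))
          - (((L μ).adjoint * L μ) * X + X * ((L μ).adjoint * L μ))) := by
  simp [heisenbergGenerator, mul_assoc]

/-- Because `X† X v = ‖X‖² v`, an `X` standing leftmost can be removed: `⟨Xv, Xw⟩ = ‖X‖² ⟨v, w⟩`.
The commutator then contributes `i` times a real number, and each jump term is at most `-(‖L X v‖ -
‖X‖ ‖L v‖)²`. -/
theorem re_inner_heisenbergGenerator_nonpos {ι : Type*} [Fintype ι] {H : Op V}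
    (hH : IsSelfAdjoint H) (L : ι → Op V) {X : Op V} {v : V} (hv : ‖v‖ = 1)
    (hX : ‖X v‖ = ‖X‖) : (inner ℂ (X v) (heisenbergGenerator H L X v)).re ≤ 0 := by
  have hadj := adjoint_apply_of_norm_apply_eq hv hX
  have hmove : ∀ w, inner ℂ (X v) (X w) = ((‖X‖ ^ 2 : ℝ) : ℂ) * inner ℂ v w := fun w => by
    rw [← ContinuousLinearMap.adjoint_inner_left, hadj, inner_smul_left, Complex.conj_ofReal]
  have hreal : ∀ w : V, (inner ℂ w (H w)).im = 0 := fun w => by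
    have := (ContinuousLinearMap.isSelfAdjoint_iff_isSymmetric.1 hH).im_inner_self_apply w
    simpa using this
  have opMulApply : ∀ (A B : Op V) (w : V), (A * B) w = A (B w) := fun _ _ _ => rfl
  rw [heisenbergGenerator_apply]
  simp only [add_apply, smul_apply, sub_apply, sum_apply,
    opMulApply, inner_add_right, inner_sum, Complex.add_re, Complex.re_sum]
  refine add_nonpos ?_ (Finset.sum_nonpos fun μ _ => ?_)
  · rw [inner_smul_right, inner_sub_right, hmove]
    simp only [Complex.I_mul_re, Complex.sub_im, Complex.im_ofReal_mul,
      hreal]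
    simp
  · rw [inner_sub_right, inner_add_right, inner_smul_right, hmove]
    simp only [ContinuousLinearMap.adjoint_inner_right]
    rw [inner_self_eq_norm_sq_to_K, inner_self_eq_norm_sq_to_K]
    have h1 : (inner ℂ (L μ (X v)) (X (L μ v))).re ≤ ‖L μ (X v)‖ * (‖X‖ * ‖L μ v‖) :=
      (Complex.re_le_norm _).trans ((norm_inner_le_norm _ _).trans (by
        gcongr; exact X.le_opNorm _))
    have h2 : ((2 : ℂ) * inner ℂ (L μ (X v)) (X (L μ v))
        - ((‖L μ (X v)‖ : ℂ) ^ 2 + ((‖X‖ ^ 2 : ℝ) : ℂ) * (‖L μ v‖ : ℂ) ^ 2)).re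
        = 2 * (inner ℂ (L μ (X v)) (X (L μ v))).re
          - (‖L μ (X v)‖ ^ 2 + ‖X‖ ^ 2 * ‖L μ v‖ ^ 2) := by
      have e : ((‖L μ (X v)‖ : ℂ) ^ 2 + ((‖X‖ ^ 2 : ℝ) : ℂ) * (‖L μ v‖ : ℂ) ^ 2)
        = ((‖L μ (X v)‖ ^ 2 + ‖X‖ ^ 2 * ‖L μ v‖ ^ 2 : ℝ) : ℂ) := by push_cast; ring
      rw [e, Complex.sub_re, Complex.ofReal_re]
      simp
    refine h2.trans_le ?_
    nlinarith [sq_nonneg (‖L μ (X v)‖ - ‖X‖ * ‖L μ v‖)]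

/-- The Heisenberg generator is dissipative for the operator norm. -/
theorem re_mul_norm_le_norm_smul_sub_heisenbergGenerator [FiniteDimensional ℂ V] {ι : Type*}
    [Fintype ι] {H : Op V}
    (hH : IsSelfAdjoint H) (L : ι → Op V) (z : ℂ) (X : Op V) :
    z.re * ‖X‖ ≤ ‖z • X - heisenbergGenerator H L X‖ := by
  rcases subsingleton_or_nontrivial V with hV | hV
  · have : X = 0 := Subsingleton.elim _ _
    simp [this]
  rcases eq_or_ne X 0 with rfl | hX0
  · simp
  obtain ⟨v, hv, hX⟩ := exists_unit_norm_apply_eq_opNorm X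
  have hpos : 0 < ‖X‖ := norm_pos_iff.2 hX0
  have h1 := re_inner_heisenbergGenerator_nonpos hH L hv hX
  have h2 : (inner ℂ (X v) ((z • X - heisenbergGenerator H L X) v)).re
      = z.re * ‖X‖ ^ 2 - (inner ℂ (X v) (heisenbergGenerator H L X v)).re := by
    simp only [sub_apply, smul_apply, inner_sub_right, inner_smul_right, Complex.sub_re]
    rw [inner_self_eq_norm_sq_to_K, hX]
    congr 1
    have : z * (‖X‖ : ℂ) ^ 2 = z * ((‖X‖ ^ 2 : ℝ) : ℂ) := by push_cast; ring
    exact (congrArg Complex.re this).trans (Complex.re_mul_ofReal _ _)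
  have h3 : (inner ℂ (X v) ((z • X - heisenbergGenerator H L X) v)).re
      ≤ ‖X‖ * ‖z • X - heisenbergGenerator H L X‖ := by
    refine (Complex.re_le_norm _).trans ((norm_inner_le_norm _ _).trans ?_)
    rw [hX]
    gcongr
    simpa [hv] using (z • X - heisenbergGenerator H L X).le_opNorm v
  have h4 : ‖X‖ * (z.re * ‖X‖) ≤ ‖X‖ * ‖z • X - heisenbergGenerator H L X‖ := by nlinarith
  exact le_of_mul_le_mul_left h4 hpos

/-- The trace of operators. -/
noncomputable def opTrace (V : Type*) [NormedAddCommGroup V] [InnerProductSpace ℂ V] :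
    Op V →ₗ[ℂ] ℂ :=
  LinearMap.trace ℂ V ∘ₗ ContinuousLinearMap.coeLM ℂ

theorem opTrace_mul_comm {V : Type*} [NormedAddCommGroup V] [InnerProductSpace ℂ V] (A B : Op V) :
    opTrace V (A * B) = opTrace V (B * A) :=
  LinearMap.trace_mul_comm ℂ (A : V →ₗ[ℂ] V) (B : V →ₗ[ℂ] V)

theorem opTrace_liouvillian_mul [FiniteDimensional ℂ V] {ι : Type*} [Fintype ι] (H : Op V)
    (L : ι → Op V) (ρ X : Op V) :
    opTrace V (liouvillian H L ρ * X) = opTrace V (ρ * heisenbergGenerator H L X) := by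
  rw [liouvillian_apply, heisenbergGenerator_apply]
  simp only [add_mul, mul_add, Finset.sum_mul, Finset.mul_sum, map_add, map_sum, sub_mul, mul_sub,
    smul_mul_assoc, mul_smul_comm, map_sub, map_smul]
  congr 1
  · have h : opTrace V (H * ρ * X) = opTrace V (ρ * (X * H)) := by
      rw [mul_assoc, opTrace_mul_comm, mul_assoc]
    rw [h, mul_assoc]
    simp only [smul_eq_mul]
    ring
  · refine Finset.sum_congr rfl fun μ _ => ?_
    have h1 : opTrace V (L μ * ρ * (L μ).adjoint * X)
        = opTrace V (ρ * ((L μ).adjoint * (X * L μ))) := by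
      rw [mul_assoc, mul_assoc, opTrace_mul_comm]
      simp only [mul_assoc]
    have h2 : opTrace V ((L μ).adjoint * L μ * ρ * X)
        = opTrace V (ρ * (X * ((L μ).adjoint * L μ))) := by
      rw [mul_assoc, opTrace_mul_comm, mul_assoc]
    rw [h1, h2, mul_assoc ρ]
    simp only [smul_eq_mul]
    ring

/-- Duality argument. A rank-one `X` with `‖X‖ = ‖ρ‖` and `tr(ρX) = ‖ρ‖²` is written as the image of
some `Y` under `z` minus the Heisenberg generator, so that `‖ρ‖² = tr((zρ - 𝓛ρ)Y)` while `z.re * ‖Y‖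
≤ ‖ρ‖`. The constant is the norm of the trace functional, hence the same for all `H` and `L`. -/
theorem exists_forall_re_mul_norm_le_norm_smul_sub_liouvillian
    (V : Type*) [NormedAddCommGroup V] [InnerProductSpace ℂ V] [CompleteSpace V]
    [FiniteDimensional ℂ V] {ι : Type*} [Fintype ι] :
    ∃ C : ℝ, ∀ (H : Op V), IsSelfAdjoint H → ∀ (L : ι → Op V) (z : ℂ), 0 < z.re → ∀ ρ : Op V,
      z.re * ‖ρ‖ ≤ C * ‖z • ρ - liouvillian H L ρ‖ := by
  let τ := (opTrace V).toContinuousLinearMap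
  refine ⟨‖τ‖, fun H hH L z hz ρ => ?_⟩
  rcases subsingleton_or_nontrivial V with hV | hV
  · have : ρ = 0 := Subsingleton.elim _ _
    simp [this]
  rcases eq_or_ne ρ 0 with rfl | hρ0
  · simp
  have hpos : 0 < ‖ρ‖ := norm_pos_iff.2 hρ0
  obtain ⟨v, hv, hρ⟩ := exists_unit_norm_apply_eq_opNorm ρ
  set X : Op V := InnerProductSpace.rankOne ℂ v (ρ v) with hX
  have hXn : ‖X‖ = ‖ρ‖ := by rw [hX, InnerProductSpace.norm_rankOne, hv, hρ, one_mul]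
  set S : Op V →ₗ[ℂ] Op V := z • LinearMap.id - heisenbergGenerator H L with hS
  have hbd : ∀ Y, z.re * ‖Y‖ ≤ ‖S Y‖ := fun Y =>
    re_mul_norm_le_norm_smul_sub_heisenbergGenerator hH L z Y
  have hinj : Function.Injective S := by
    rw [← LinearMap.ker_eq_bot, LinearMap.ker_eq_bot']
    intro Y hY
    have := hbd Y
    rw [hY, norm_zero] at this
    have h0 : ‖Y‖ ≤ 0 := by
      by_contra! h
      nlinarith [mul_pos hz h]
    exact norm_le_zero_iff.1 h0
  obtain ⟨Y, hY⟩ := LinearMap.injective_iff_surjective.1 hinj X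
  have hYn : z.re * ‖Y‖ ≤ ‖ρ‖ := by simpa [hY, hXn] using hbd Y
  have htr : opTrace V (ρ * X) = (‖ρ‖ : ℂ) ^ 2 := by
    have : ρ * X = InnerProductSpace.rankOne ℂ (ρ v) (ρ v) := by
      ext w; simp [hX]
    rw [this, ← hρ]
    have := InnerProductSpace.trace_rankOne (𝕜 := ℂ) (ρ v) (ρ v)
    rw [inner_self_eq_norm_sq_to_K] at this
    exact this
  have htr2 : opTrace V ((z • ρ - liouvillian H L ρ) * Y) = opTrace V (ρ * X) := by
    rw [← hY, sub_mul, map_sub, opTrace_liouvillian_mul, ← map_sub, hS]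
    simp [mul_sub]
  have h1 : ‖ρ‖ ^ 2 ≤ ‖τ‖ * (‖z • ρ - liouvillian H L ρ‖ * ‖Y‖) := by
    have h := (τ.le_opNorm ((z • ρ - liouvillian H L ρ) * Y)).trans
      (mul_le_mul_of_nonneg_left (norm_mul_le _ _) (norm_nonneg _))
    have e : τ ((z • ρ - liouvillian H L ρ) * Y) = (‖ρ‖ : ℂ) ^ 2 := htr2.trans htr
    rw [e] at h
    simpa using h
  have h2 : ‖ρ‖ * (z.re * ‖ρ‖) ≤ ‖ρ‖ * (‖τ‖ * ‖z • ρ - liouvillian H L ρ‖) := by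
    calc ‖ρ‖ * (z.re * ‖ρ‖) = z.re * ‖ρ‖ ^ 2 := by ring
      _ ≤ z.re * (‖τ‖ * (‖z • ρ - liouvillian H L ρ‖ * ‖Y‖)) := by gcongr
      _ = ‖τ‖ * ‖z • ρ - liouvillian H L ρ‖ * (z.re * ‖Y‖) := by ring
      _ ≤ ‖τ‖ * ‖z • ρ - liouvillian H L ρ‖ * ‖ρ‖ := by gcongr
      _ = _ := by ring
  exact le_of_mul_le_mul_left h2 hpos

/-- The dissipator of `L(s)` is stationary to first order if `L(s)` is. -/
theorem hasDerivAt_jumpDissipator_zero [FiniteDimensional ℂ V] {L : ℝ → Op V} {s : ℝ}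
    (hL : HasDerivAt L 0 s) :
    HasDerivAt (fun s => jumpDissipator (L s)) 0 s := by
  let R := (ContinuousLinearMap.mul ℂ (Op V)).flip
  let l := ContinuousLinearMap.mul ℂ (Op V)
  have hLs : HasDerivAt (fun s => (L s).adjoint) 0 s := 
    hL.star.congr_deriv (star_zero _)
  -- In terms of left and right multiplication operators the dissipator is a sum of products, to
  -- which the product rule applies.
  have e : (fun s => jumpDissipator (L s)) = fun s =>
      (2 : ℂ) • ((l (L s)).comp (R (L s).adjoint))
        - (l ((L s).adjoint * L s) + R ((L s).adjoint * L s)) := by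
    funext s
    refine ContinuousLinearMap.ext fun ρ => ?_
    simp [jumpDissipator, l, R, mul_assoc]
  have hl : ∀ {f : ℝ → Op V}, HasDerivAt f 0 s → HasDerivAt (fun s => l (f s)) 0 s := by
    intro f hf
    exact ((l.restrictScalars ℝ).hasFDerivAt.comp_hasDerivAt s hf).congr_deriv (map_zero _)
  have hR : ∀ {f : ℝ → Op V}, HasDerivAt f 0 s → HasDerivAt (fun s => R (f s)) 0 s := by
    intro f hf
    exact ((R.restrictScalars ℝ).hasFDerivAt.comp_hasDerivAt s hf).congr_deriv (map_zero _)
  have hm : HasDerivAt (fun s => (L s).adjoint * L s) 0 s := 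
    (hLs.mul hL).congr_deriv (by simp)
  rw [e]
  have h1 : HasDerivAt (fun s => (l (L s)).comp (R (L s).adjoint)) 0 s :=
    ((hl hL).mul (hR hLs)).congr_deriv (by simp)
  exact ((h1.const_smul (2 : ℂ)).sub ((hl hm).add (hR hm))).congr_deriv (by simp)

theorem hasDerivAt_unitaryGenerator [FiniteDimensional ℂ V] {H : ℝ → Op V} {H' : Op V} {s : ℝ}
    (hH : HasDerivAt H H' s) :
    HasDerivAt (fun s => unitaryGenerator (H s)) (unitaryGenerator H') s := by
  let R := (ContinuousLinearMap.mul ℂ (Op V)).flip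
  let l := ContinuousLinearMap.mul ℂ (Op V)
  have e : ∀ H : Op V, unitaryGenerator H = ((-Complex.I) • (l - R)) H := by
    intro H
    refine ContinuousLinearMap.ext fun ρ => ?_
    simp [unitaryGenerator, l, R]
  simp only [e]
  exact ((((-Complex.I) • (l - R)).restrictScalars ℝ).hasFDerivAt.comp_hasDerivAt s hH)

theorem eq_and_hasDerivAt_of_isBigO_sq {E : Type*} [NormedAddCommGroup E] [NormedSpace ℝ E]
    {f : ℝ → E} {a b : E} (h : (fun s : ℝ => f s - (a + s • b)) =O[𝓝 0] (fun s : ℝ => s ^ 2)) :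
    f 0 = a ∧ HasDerivAt f b 0 := by
  -- The neighbourhood filter includes the point `0`, where the bound `s ^ 2` vanishes.
  have h0 : f 0 = a := by
    simpa [sub_eq_zero] using h.eq_zero_imp.self_of_nhds
  refine ⟨h0, ?_⟩
  rw [hasDerivAt_iff_isLittleO]
  have h2 : (fun s : ℝ => s ^ 2) =o[𝓝 0] (fun s : ℝ => s - 0) := by
    simpa using (isLittleO_pow_id (𝕜 := ℝ) (n := 2) (by norm_num))
  refine (h.trans_isLittleO h2).congr_left fun s => ?_
  rw [h0, sub_zero]
  abel

theorem hasDerivAt_liouvillian [FiniteDimensional ℂ V] {ι : Type*} [Fintype ι] {H : ℝ → Op V}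
    {L : ℝ → ι → Op V}
    {H' : Op V} {s : ℝ} (hH : HasDerivAt H H' s) (hL : ∀ μ, HasDerivAt (fun s => L s μ) 0 s) :
    HasDerivAt (fun s => liouvillian (H s) (L s)) (unitaryGenerator H') s := by
  have h := (hasDerivAt_unitaryGenerator hH).add
    (HasDerivAt.fun_sum (u := Finset.univ) fun μ _ => hasDerivAt_jumpDissipator_zero (hL μ))
  exact h.congr_deriv (by simp)

end Dissipative

/-! ### Eigenvalues near an imaginary eigenvalue, up to `O(s²)` -/

section SpectralInclusion

variable {E : Type*} [NormedAddCommGroup E] [NormedSpace ℂ E]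

theorem le_of_eventually_le_add_mul {a b K : ℝ} (h : ∀ᶠ t in 𝓝[>] (0 : ℝ), a ≤ b + t * K) :
    a ≤ b := by
  have : Tendsto (fun t : ℝ => b + t * K) (𝓝[>] 0) (𝓝 (b + 0 * K)) :=
    (Continuous.tendsto (by fun_prop) 0).mono_left nhdsWithin_le_nhds
  simpa using ge_of_tendsto this h

/-- A resolvent bound `‖(z₀ + h - f)⁻¹‖ ≤ C / h` for `h > 0` excludes Jordan blocks at `z₀`. -/
theorem apply_sub_smul_eq_zero_of_resolvent_bound {f : E →ₗ[ℂ] E} {z₀ : ℂ} {C : ℝ}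
    (hf : ∀ h : ℝ, 0 < h → ∀ x, h * ‖x‖ ≤ C * ‖(z₀ + h) • x - f x‖) {x : E}
    (hx : f (f x - z₀ • x) = z₀ • (f x - z₀ • x)) : f x = z₀ • x := by
  set y := f x - z₀ • x with hy
  have hfx : f x = z₀ • x + y := by rw [hy]; abel
  suffices h : ‖y‖ ≤ 0 by rw [hfx, norm_le_zero_iff.1 h, add_zero]
  refine le_of_eventually_le_add_mul (K := C * ‖x‖ + ‖x‖) ?_
  filter_upwards [self_mem_nhdsWithin] with t (ht : 0 < t)
  have htC : (t : ℂ) ≠ 0 := by exact_mod_cast ht.ne'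
  -- The test vector blows up along the Jordan chain, yet `z₀ + t - f` sends it to `t • x`. The
  -- bound becomes `‖t x + y‖ ≤ C t ‖x‖`, which forces `y = 0` as `t → 0`.
  have h1 := hf t ht (x + (t : ℂ)⁻¹ • y)
  have h2 : (z₀ + t) • (x + (t : ℂ)⁻¹ • y) - f (x + (t : ℂ)⁻¹ • y) = (t : ℂ) • x := by
    rw [map_add, map_smul, hx, hfx]
    have : (t : ℂ) • (t : ℂ)⁻¹ • y = y := smul_inv_smul₀ htC y
    linear_combination (norm := module) this
  have h3 : t * ‖x + (t : ℂ)⁻¹ • y‖ = ‖(t : ℂ) • x + y‖ := by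
    rw [← smul_inv_smul₀ htC y, ← smul_add, norm_smul, Complex.norm_real,
      Real.norm_of_nonneg ht.le, smul_inv_smul₀ htC y]
  rw [h2, h3, norm_smul, Complex.norm_real, Real.norm_of_nonneg ht.le] at h1
  have h4 : ‖y‖ ≤ ‖(t : ℂ) • x + y‖ + ‖(t : ℂ) • x‖ := by
    simpa using norm_sub_le ((t : ℂ) • x + y) ((t : ℂ) • x)
  rw [norm_smul, Complex.norm_real, Real.norm_of_nonneg ht.le] at h4
  nlinarith

theorem maxGenEigenspace_eq_eigenspace_of_resolvent_bound {f : E →ₗ[ℂ] E} {z₀ : ℂ} {C : ℝ}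
    (hf : ∀ h : ℝ, 0 < h → ∀ x, h * ‖x‖ ≤ C * ‖(z₀ + h) • x - f x‖) :
    Module.End.maxGenEigenspace f z₀ = Module.End.eigenspace f z₀ := by
  refine le_antisymm (fun x hx => ?_) Module.End.eigenspace_le_maxGenEigenspace
  obtain ⟨k, hk⟩ := (Module.End.mem_maxGenEigenspace f z₀ x).1 hx
  have key : ∀ (k : ℕ) (x : E), ((f - z₀ • (1 : Module.End ℂ E)) ^ k) x = 0 → f x = z₀ • x := by
    intro k
    induction k with
    | zero => intro x hx; simp at hx; simp [hx]
    | succ k ih =>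
      intro x hx
      rw [pow_succ, Module.End.mul_apply] at hx
      exact apply_sub_smul_eq_zero_of_resolvent_bound hf (by simpa using ih _ hx)
  exact Module.End.mem_eigenspace_iff.2 (key k x hk)

/-- An operator with the resolvent bound `‖(z - B)⁻¹‖ ≤ C / |Re z|` is diagonalizable with
imaginary eigenvalues, so that its resolvent is controlled by the distance to the spectrum. -/
theorem exists_finset_norm_sub_mul_norm_le [FiniteDimensional ℂ E] {B : E →L[ℂ] E} {C : ℝ}
    (hB : ∀ (z : ℂ) (x : E), |z.re| * ‖x‖ ≤ C * ‖z • x - B x‖) :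
    ∃ (S : Finset ℝ) (c : ℝ), 0 ≤ c ∧ ∀ (ζ : ℂ) (s : ℝ) (y : E), y ≠ 0 → ∃ α ∈ S,
      ‖ζ - Complex.I * α * s‖ * ‖y‖ ≤ c * ‖ζ • y - (s : ℂ) • B y‖ := by
  classical
  set f : Module.End ℂ E := B.toLinearMap with hfdef
  set R : Finset ℂ := f.charpoly.roots.toFinset with hR
  have hmemR : ∀ β, β ∈ R ↔ f.HasEigenvalue β := fun β => by
    rw [hR, Multiset.mem_toFinset, Polynomial.mem_roots f.charpoly_monic.ne_zero,
      Module.End.hasEigenvalue_iff_isRoot_charpoly]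
  have himag : ∀ β ∈ R, β.re = 0 := fun β hβ => by
    obtain ⟨x, hx⟩ := ((hmemR β).1 hβ).exists_hasEigenvector
    have h1 : B x = β • x := hx.apply_eq_smul
    have h2 := hB β x
    rw [h1, sub_self, norm_zero, mul_zero] at h2
    have h3 : 0 < ‖x‖ := norm_pos_iff.2 hx.2
    have h4 : |β.re| ≤ 0 := by
      by_contra! h
      nlinarith [mul_pos h h3]
    exact abs_nonpos_iff.1 h4
  have hsemi : ∀ β, f.maxGenEigenspace β = f.eigenspace β := by
    intro β
    by_cases hβ : β ∈ R
    · refine maxGenEigenspace_eq_eigenspace_of_resolvent_bound (C := C) fun h hh x => ?_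
      have h1 := hB (β + h) x
      rw [Complex.add_re, himag β hβ, Complex.ofReal_re, zero_add, abs_of_pos hh] at h1
      exact h1
    · have h1 : f.eigenspace β = ⊥ := by
        by_contra h
        exact hβ ((hmemR β).2 h)
      refine le_antisymm (fun x hx => ?_) Module.End.eigenspace_le_maxGenEigenspace
      obtain ⟨k, hk⟩ := (Module.End.mem_maxGenEigenspace f β x).1 hx
      have hinj : Function.Injective (f - β • (1 : Module.End ℂ E)) := by
        rw [← LinearMap.ker_eq_bot, ← h1, Module.End.eigenspace_def]
      have : x = 0 := by
        have h2 : Function.Injective ((f - β • (1 : Module.End ℂ E)) ^ k) := by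
          rw [Module.End.coe_pow]; exact hinj.iterate k
        exact h2 (by rw [hk, map_zero])
      rw [this]; exact Submodule.zero_mem _
  -- Without Jordan blocks, the product of `f - β` over distinct eigenvalues kills every generalized
  -- eigenspace, and these span.
  have hnodal : Polynomial.aeval f (Lagrange.nodal R id) = 0 := by
    rw [← LinearMap.ker_eq_top, eq_top_iff, ← Module.End.iSup_maxGenEigenspace_eq_top f]
    refine iSup_le fun β x hx => ?_
    rw [hsemi, Module.End.mem_eigenspace_iff] at hx
    rw [LinearMap.mem_ker]
    rcases eq_or_ne x 0 with rfl | hx0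
    · simp
    have hβ : β ∈ R := (hmemR β).2 (Module.End.hasEigenvalue_of_hasEigenvector
      ⟨Module.End.mem_eigenspace_iff.2 hx, hx0⟩)
    rw [Lagrange.nodal_eq_mul_nodal_erase hβ, mul_comm, map_mul, Module.End.mul_apply]
    simp [hx]
  -- The spectral projections of `B`, as Lagrange interpolation polynomials in `B`.
  set Q : ℂ → (E →L[ℂ] E) := fun β =>
    LinearMap.toContinuousLinearMap (Polynomial.aeval f (Lagrange.basis R id β)) with hQ
  have hQB : ∀ β ∈ R, ∀ y, Q β (B y) = β • Q β y := by
    intro β hβ y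
    have h1 : (Lagrange.basis R id β) * (Polynomial.X - Polynomial.C β)
        = Polynomial.C (Lagrange.nodalWeight R id β) * Lagrange.nodal R id := by
      rw [Lagrange.basis_eq_prod_sub_inv_mul_nodal_div hβ, ← Lagrange.nodal_erase_eq_nodal_div hβ,
        Lagrange.nodal_eq_mul_nodal_erase hβ, id]
      ring
    have h2 := congrArg (fun p => Polynomial.aeval f p y) h1
    simp only [map_mul, hnodal, Module.End.mul_apply, map_sub, Polynomial.aeval_X,
      Polynomial.aeval_C] at h2
    simp [sub_eq_zero] at h2
    exact h2
  have hsum : ∀ y, y ≠ 0 → R.Nonempty ∧ ∑ β ∈ R, Q β y = y := by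
    intro y hy
    have hne : R.Nonempty := by
      by_contra h
      rw [Finset.not_nonempty_iff_eq_empty] at h
      rw [h] at hnodal
      have := LinearMap.congr_fun hnodal y
      simp at this
      exact hy this
    refine ⟨hne, ?_⟩
    have h1 := congrArg (fun p => Polynomial.aeval f p y)
      (Lagrange.sum_basis (s := R) (v := id) Function.injective_id.injOn hne)
    simpa [hQ] using h1
  refine ⟨R.image Complex.im, ∑ β ∈ R, ‖Q β‖, Finset.sum_nonneg fun _ _ => norm_nonneg _,
    fun ζ s y hy => ?_⟩
  obtain ⟨hne, hy1⟩ := hsum y hy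
  -- The eigenvalue for which `β * s` is closest to `ζ`: its distance bounds all spectral components
  -- from below at once.
  obtain ⟨β₀, hβ₀, hmin⟩ := R.exists_min_image (fun β => ‖ζ - β * s‖) hne
  refine ⟨β₀.im, Finset.mem_image_of_mem _ hβ₀, ?_⟩
  have hβ₀' : Complex.I * β₀.im = β₀ := by
    apply Complex.ext <;> simp [himag β₀ hβ₀]
  rw [hβ₀']
  calc ‖ζ - β₀ * s‖ * ‖y‖ = ‖ζ - β₀ * s‖ * ‖∑ β ∈ R, Q β y‖ := by rw [hy1]
    _ ≤ ‖ζ - β₀ * s‖ * ∑ β ∈ R, ‖Q β y‖ := by gcongr; exact norm_sum_le _ _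
    _ = ∑ β ∈ R, ‖ζ - β₀ * s‖ * ‖Q β y‖ := Finset.mul_sum _ _ _
    _ ≤ ∑ β ∈ R, ‖Q β‖ * ‖ζ • y - (s : ℂ) • B y‖ := by
        refine Finset.sum_le_sum fun β hβ => ?_
        calc ‖ζ - β₀ * s‖ * ‖Q β y‖ ≤ ‖ζ - β * s‖ * ‖Q β y‖ := by gcongr; exact hmin β hβ
          _ = ‖Q β (ζ • y - (s : ℂ) • B y)‖ := by
              rw [map_sub, map_smul, map_smul, hQB β hβ, ← norm_smul, sub_smul, mul_comm, mul_smul]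
          _ ≤ _ := (Q β).le_opNorm _
    _ = _ := (Finset.sum_mul _ _ _).symm

/-- A family of operators with uniform one-sided resolvent bounds has, near an imaginary
eigenvalue `i ω`, eigenvalues lying within `O(s²)` of finitely many imaginary lines. -/
theorem exists_norm_eigenvalue_sub_le_sq [FiniteDimensional ℂ E] {A : ℝ → E →L[ℂ] E}
    {D : E →L[ℂ] E} {C : ℝ}
    (hC : ∀ (s : ℝ) (z : ℂ), 0 < z.re → ∀ x, z.re * ‖x‖ ≤ C * ‖z • x - A s x‖)
    (hA : (fun s : ℝ => A s - (A 0 + s • D)) =O[𝓝 0] (fun s : ℝ => s ^ 2)) (ω : ℝ) :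
    ∃ (S : Finset ℝ) (K r : ℝ), 0 < r ∧ ∀ᶠ s : ℝ in 𝓝 0, ∀ μ : ℂ, ‖μ‖ < r →
      Module.End.HasEigenvalue (A s).toLinearMap (Complex.I * ω + μ) →
        ∃ α ∈ S, ‖μ - Complex.I * α * s‖ ≤ K * s ^ 2 := by
  wlog hC0 : 0 ≤ C generalizing C
  · exact this (C := |C|) (fun s z hz x => (hC s z hz x).trans (by gcongr; exact le_abs_self C))
      (abs_nonneg C)
  set N : E →L[ℂ] E := A 0 - (Complex.I * ω) • ContinuousLinearMap.id ℂ E with hN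
  have hNx : ∀ x, N x = A 0 x - (Complex.I * ω) • x := fun x => by simp [hN]
  have hNN : ∀ x, N (N x) = 0 → N x = 0 := by
    intro x hx
    have := apply_sub_smul_eq_zero_of_resolvent_bound (f := (A 0).toLinearMap)
      (z₀ := Complex.I * ω) (C := C) (fun h hh x => by
        have := hC 0 (Complex.I * ω + h) (by simpa using hh) x
        simpa using this) (x := x) (by simpa [hNx, sub_eq_zero] using hx)
    rw [hNx, sub_eq_zero]; exact this
  have hcompl : IsCompl (LinearMap.ker N.toLinearMap) (LinearMap.range N.toLinearMap) := by
    refine Submodule.isCompl_iff_disjoint _ _ ?_ |>.2 ?_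
    · rw [add_comm, LinearMap.finrank_range_add_finrank_ker]
    · rw [Submodule.disjoint_def]
      rintro x hx ⟨w, rfl⟩
      exact hNN w hx
  obtain ⟨P, hPker, hPfix, hPN, hPrange⟩ : ∃ P : E →L[ℂ] E, (∀ x, N (P x) = 0) ∧
      (∀ x, N x = 0 → P x = x) ∧ (∀ w, P (N w) = 0) ∧ ∀ x, ∃ w, x - P x = N w := by
    refine ⟨LinearMap.toContinuousLinearMap (Submodule.projection _ _ hcompl), ?_, ?_, ?_, ?_⟩
    · intro x
      exact (Submodule.projection_apply_mem hcompl x : _)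
    · intro x hx
      exact Submodule.projection_apply_left hcompl ⟨x, hx⟩
    · intro w
      exact (Submodule.projection_apply_eq_zero_iff hcompl).2 ⟨w, rfl⟩
    · intro x
      have h : x - Submodule.projection _ _ hcompl x ∈ LinearMap.range N.toLinearMap := by
        rw [← Submodule.projection_apply_eq_zero_iff hcompl, map_sub, sub_eq_zero]
        exact (Submodule.projection_apply_left hcompl
          ⟨_, Submodule.projection_apply_mem hcompl x⟩).symm
      obtain ⟨w, hw⟩ := h
      exact ⟨w, hw.symm⟩
  have hPP : ∀ x, P (P x) = P x := fun x => hPfix _ (hPker x)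
  -- `N + P` is invertible and agrees with `N` on `x - P x`, so `c` can be taken as a bound for its
  -- inverse.
  obtain ⟨c, hc0, hc⟩ : ∃ c : ℝ, 0 ≤ c ∧ ∀ x, ‖x - P x‖ ≤ c * ‖N x‖ := by
    have hinj : LinearMap.ker (N + P).toLinearMap = ⊥ := by
      rw [LinearMap.ker_eq_bot']
      intro x hx
      have hx' : N x + P x = 0 := hx
      have h1 : P x = 0 := by
        have := congrArg P hx'
        simpa [hPN, hPP] using this
      have h2 : N x = 0 := by simpa [h1] using hx'
      rw [← hPfix x h2, h1]
    obtain ⟨k, -, hk⟩ := (N + P).toLinearMap.exists_antilipschitzWith hinj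
    refine ⟨k, k.2, fun x => ?_⟩
    have h1 := hk.le_mul_dist (x - P x) 0
    simpa [hPker, hPP] using h1
  set B : E →L[ℂ] E := P.comp (D.comp P) with hB
  set P' : E →L[ℂ] E := ContinuousLinearMap.id ℂ E - P with hP'
  have hP'x : ∀ x, P' x = x - P x := fun x => by simp [hP']
  obtain ⟨M, hMbig⟩ := hA.bound
  have hres : ∀ (z : ℂ) (x : E), N x = 0 → |z.re| * ‖x‖ ≤ C * ‖z • x - P (D x)‖ := by
    intro z x hx
    rcases eq_or_ne z.re 0 with hz | hz
    · rw [hz, abs_zero, zero_mul]; positivity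
    -- First-order perturbation theory: with `N w = P D x - D x`, the vector `x + s w` is mapped by
    -- `iω + s z - A s` to `s (z x - P D x) + O(s²)`. Dividing the resolvent bound by `|s|` and
    -- letting `s → 0` gives the claim.
    obtain ⟨w', hw'⟩ := hPrange (D x)
    set w := -w' with hw
    have hNw : N w = P (D x) - D x := by rw [hw, map_neg, ← hw']; abel
    -- The sign of `s` is chosen so that `s * z` has positive real part. This is what turns the
    -- one-sided bound into a two-sided one.
    obtain ⟨σ, hσ, hσz⟩ : ∃ σ : ℝ, |σ| = 1 ∧ σ * z.re = |z.re| := by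
      rcases hz.lt_or_gt with h | h
      · exact ⟨-1, by simp, by rw [abs_of_neg h]; ring⟩
      · exact ⟨1, by simp, by rw [abs_of_pos h]; ring⟩
    refine le_of_eventually_le_add_mul
      (K := |z.re| * ‖w‖ + C * (‖z • w - D w‖ + |M| * (‖x‖ + ‖w‖))) ?_
    have htend : Tendsto (fun t : ℝ => σ * t) (𝓝[>] 0) (𝓝 0) := by
      have : Tendsto (fun t : ℝ => σ * t) (𝓝 0) (𝓝 (σ * 0)) :=
        Continuous.tendsto (by fun_prop) 0
      rw [mul_zero] at this
      exact this.mono_left nhdsWithin_le_nhds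
    filter_upwards [self_mem_nhdsWithin, htend.eventually hMbig,
      nhdsWithin_le_nhds (Iio_mem_nhds (zero_lt_one))] with t (ht : 0 < t) hMt (ht1 : t < 1)
    set s := σ * t with hs
    have hsabs : |s| = t := by rw [hs, abs_mul, hσ, one_mul, abs_of_pos ht]
    set e : E →L[ℂ] E := A s - (A 0 + s • D) with he
    have hAs : ∀ v, A s v = A 0 v + (s : ℂ) • D v + e v := fun v => by
      simp [he]
    have hre : (Complex.I * ω + s * z).re = t * |z.re| := by
      simp only [Complex.add_re, Complex.mul_re, Complex.I_re, Complex.I_im,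
        Complex.ofReal_re, Complex.ofReal_im]
      rw [← hσz, hs]; ring
    have h1 := hC s (Complex.I * ω + s * z) (by rw [hre]; positivity) (x + (s : ℂ) • w)
    have h2 : (Complex.I * ω + s * z) • (x + (s : ℂ) • w) - A s (x + (s : ℂ) • w)
        = (s : ℂ) • (z • x - P (D x)) + (((s : ℂ) ^ 2) • (z • w - D w)
          - e (x + (s : ℂ) • w)) := by
      rw [hNx] at hx hNw
      rw [hAs, map_add, map_add, map_smul, map_smul]
      linear_combination (norm := module) -hx - (s : ℂ) • hNw
    have hew : ‖e (x + (s : ℂ) • w)‖ ≤ t ^ 2 * (|M| * (‖x‖ + ‖w‖)) := by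
      have ha : ‖e‖ ≤ |M| * t ^ 2 := by
        refine hMt.trans ?_
        rw [norm_pow, Real.norm_eq_abs, hsabs]
        gcongr; exact le_abs_self M
      have hb : ‖x + (s : ℂ) • w‖ ≤ ‖x‖ + ‖w‖ := by
        refine (norm_add_le _ _).trans ?_
        rw [norm_smul, Complex.norm_real, Real.norm_eq_abs, hsabs]
        nlinarith [norm_nonneg w]
      calc _ ≤ ‖e‖ * ‖x + (s : ℂ) • w‖ := e.le_opNorm _
        _ ≤ (|M| * t ^ 2) * (‖x‖ + ‖w‖) := by gcongr
        _ = _ := by ring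
    have h3 : ‖(Complex.I * ω + s * z) • (x + (s : ℂ) • w) - A s (x + (s : ℂ) • w)‖
        ≤ t * ‖z • x - P (D x)‖ + (t ^ 2 * ‖z • w - D w‖ + t ^ 2 * (|M| * (‖x‖ + ‖w‖))) := by
      rw [h2]
      refine (norm_add_le _ _).trans (add_le_add ?_ ((norm_sub_le _ _).trans (add_le_add ?_ hew)))
      · rw [norm_smul, Complex.norm_real, Real.norm_eq_abs, hsabs]
      · rw [norm_smul, norm_pow, Complex.norm_real, Real.norm_eq_abs, hsabs]
    have h4 : ‖x‖ - t * ‖w‖ ≤ ‖x + (s : ℂ) • w‖ := by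
      have := norm_sub_norm_le x (-((s : ℂ) • w))
      rwa [norm_neg, norm_smul, Complex.norm_real, Real.norm_eq_abs, hsabs, sub_neg_eq_add] at this
    rw [hre] at h1
    have h5 : t * (|z.re| * (‖x‖ - t * ‖w‖)) ≤ t * (C * (‖z • x - P (D x)‖
        + (t * ‖z • w - D w‖ + t * (|M| * (‖x‖ + ‖w‖))))) := by
      calc t * (|z.re| * (‖x‖ - t * ‖w‖)) = t * |z.re| * (‖x‖ - t * ‖w‖) := by ring
        _ ≤ t * |z.re| * ‖x + (s : ℂ) • w‖ := by gcongr
        _ ≤ _ := h1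
        _ ≤ C * _ := mul_le_mul_of_nonneg_left h3 hC0
        _ = _ := by ring
    have h6 := le_of_mul_le_mul_left h5 ht
    linarith
  have hBres : ∀ (z : ℂ) (x : E), |z.re| * ‖x‖ ≤ (C * ‖P‖ + ‖P'‖) * ‖z • x - B x‖ := by
    intro z x
    have h1 := hres z (P x) (hPker x)
    have h2 : z • P x - P (D (P x)) = P (z • x - B x) := by simp [hB, hPP]
    have h3 : z • P' x = P' (z • x - B x) := by
      simp only [hP'x, hB, map_sub, map_smul, ContinuousLinearMap.comp_apply, hPP]; module
    have h4 : ‖z‖ * ‖P' x‖ ≤ ‖P'‖ * ‖z • x - B x‖ := by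
      rw [← norm_smul, h3]; exact P'.le_opNorm _
    have h5 : |z.re| * ‖P x‖ ≤ C * (‖P‖ * ‖z • x - B x‖) := by
      rw [h2] at h1
      exact h1.trans (mul_le_mul_of_nonneg_left (P.le_opNorm _) hC0)
    have h6 : ‖x‖ ≤ ‖P x‖ + ‖P' x‖ := by
      have : x = P x + P' x := by rw [hP'x]; abel
      conv_lhs => rw [this]
      exact norm_add_le _ _
    have h7 : |z.re| * ‖P' x‖ ≤ ‖z‖ * ‖P' x‖ := by gcongr; exact Complex.abs_re_le_norm z
    have h8 : |z.re| * ‖x‖ ≤ |z.re| * (‖P x‖ + ‖P' x‖) := by gcongr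
    linarith
  obtain ⟨S, b, hb0, hS⟩ := exists_finset_norm_sub_mul_norm_le hBres
  set K₁ : ℝ := ‖P'‖ * (‖D‖ + |M|) with hK₁
  set K₂ : ℝ := ‖P‖ * ‖D‖ * (2 * c * K₁) + ‖P‖ * |M| with hK₂
  -- The radius ensures `c * ‖μ‖ ≤ 1 / 2`, which lets `‖P' x‖` be absorbed and shown to be `O(s)`.
  -- The factor `2` compensates for `‖P x‖ ≥ 1 / 2`.
  refine ⟨S, 2 * (b * K₂), 1 / (2 * c + 1), by positivity, ?_⟩
  have hsmall : ∀ᶠ s : ℝ in 𝓝 0, |s| < 1 ∧ 2 * c * K₁ * |s| < 1 / 2 := by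
    have h1 : Tendsto (fun s : ℝ => |s|) (𝓝 0) (𝓝 0) := by
      simpa using (continuous_abs (G := ℝ)).tendsto 0
    have h2 : Tendsto (fun s : ℝ => 2 * c * K₁ * |s|) (𝓝 0) (𝓝 0) := by
      simpa using h1.const_mul (2 * c * K₁)
    exact (h1.eventually_lt_const one_pos).and (h2.eventually_lt_const (by norm_num))
  filter_upwards [hMbig, hsmall] with s hMs ⟨hs1, hs2⟩ μ hμ hev
  obtain ⟨x₀, hx₀⟩ := hev.exists_hasEigenvector
  obtain ⟨x, hx1, hxA⟩ : ∃ x : E, ‖x‖ = 1 ∧ A s x = (Complex.I * ω + μ) • x := by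
    refine ⟨((‖x₀‖⁻¹ : ℝ) : ℂ) • x₀, ?_, ?_⟩
    · simp [norm_smul, inv_mul_cancel₀ (norm_ne_zero_iff.2 hx₀.2)]
    · have : A s x₀ = (Complex.I * ω + μ) • x₀ := hx₀.apply_eq_smul
      rw [map_smul, this, smul_comm]
  set e : E →L[ℂ] E := A s - (A 0 + s • D) with he
  have hAs : A s x = A 0 x + (s : ℂ) • D x + e x := by simp [he]
  have hee : ‖e x‖ ≤ |M| * |s| ^ 2 := by
    have h1 := e.le_opNorm x
    rw [hx1, mul_one] at h1
    refine h1.trans (hMs.trans ?_)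
    rw [norm_pow, Real.norm_eq_abs]
    gcongr; exact le_abs_self M
  have hNe : N x = μ • x - (s : ℂ) • D x - e x := by
    rw [hNx]; rw [hAs] at hxA
    linear_combination (norm := module) hxA
  have hN' : N x = μ • P' x - (s : ℂ) • P' (D x) - P' (e x) := by
    have h1 : N x = P' (N x) := by rw [hP'x, hPN, sub_zero]
    rw [h1, hNe]; simp
  have hNn : ‖N x‖ ≤ ‖μ‖ * ‖P' x‖ + |s| * K₁ := by
    rw [hN']
    have h1 : ‖(s : ℂ) • P' (D x)‖ ≤ |s| * (‖P'‖ * ‖D‖) := by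
      rw [norm_smul, Complex.norm_real, Real.norm_eq_abs]
      gcongr
      refine (P'.le_opNorm _).trans ?_
      gcongr
      simpa [hx1] using D.le_opNorm x
    have h2 : ‖P' (e x)‖ ≤ |s| * (‖P'‖ * |M|) := by
      calc _ ≤ ‖P'‖ * ‖e x‖ := P'.le_opNorm _
        _ ≤ ‖P'‖ * (|M| * |s| ^ 2) := by gcongr
        _ ≤ ‖P'‖ * (|M| * |s|) := by
            gcongr
            nlinarith [abs_nonneg s]
        _ = _ := by ring
    have h3 := norm_sub_le (μ • P' x - (s : ℂ) • P' (D x)) (P' (e x))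
    have h4 := norm_sub_le (μ • P' x) ((s : ℂ) • P' (D x))
    rw [norm_smul] at h4
    rw [hK₁]
    linarith
  have hP'n : ‖P' x‖ ≤ 2 * c * K₁ * |s| := by
    have h1 := hc x
    rw [← hP'x] at h1
    have h2 : c * ‖μ‖ ≤ 1 / 2 := by
      rw [lt_div_iff₀ (by positivity)] at hμ
      nlinarith [norm_nonneg μ]
    have h3 : ‖P' x‖ ≤ c * (‖μ‖ * ‖P' x‖ + |s| * K₁) := h1.trans (by gcongr)
    have h4 : c * ‖μ‖ * ‖P' x‖ ≤ 1 / 2 * ‖P' x‖ := by gcongr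
    nlinarith
  have hxP : x = P x + P' x := by rw [hP'x]; abel
  have hPx : 1 / 2 ≤ ‖P x‖ := by
    have h1 : ‖x‖ ≤ ‖P x‖ + ‖P' x‖ := by
      conv_lhs => rw [hxP]
      exact norm_add_le _ _
    rw [hx1] at h1
    linarith
  have hPx0 : P x ≠ 0 := fun h => by rw [h, norm_zero] at hPx; norm_num at hPx
  -- The eigenvalue equation projected to the kernel of `N`. The right-hand side is `O(s²)` because
  -- both `s * ‖P' x‖` and `e x` are.
  have hPeq : μ • P x - (s : ℂ) • B (P x) = (s : ℂ) • P (D (P' x)) + P (e x) := by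
    have h1 : P (N x) = μ • P x - (s : ℂ) • P (D x) - P (e x) := by rw [hNe]; simp
    rw [hPN] at h1
    have h2 : P (D x) = B (P x) + P (D (P' x)) := by
      conv_lhs => rw [hxP]
      simp [hB, hPP]
    rw [h2] at h1
    linear_combination (norm := module) -h1
  have hPn : ‖μ • P x - (s : ℂ) • B (P x)‖ ≤ K₂ * s ^ 2 := by
    rw [hPeq, ← sq_abs s]
    refine (norm_add_le _ _).trans ?_
    have h1 : ‖(s : ℂ) • P (D (P' x))‖ ≤ |s| * (‖P‖ * (‖D‖ * (2 * c * K₁ * |s|))) := by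
      rw [norm_smul, Complex.norm_real, Real.norm_eq_abs]
      gcongr
      refine (P.le_opNorm _).trans ?_
      gcongr
      refine (D.le_opNorm _).trans ?_
      gcongr
    have h2 : ‖P (e x)‖ ≤ ‖P‖ * (|M| * |s| ^ 2) := (P.le_opNorm _).trans (by gcongr)
    rw [hK₂]
    linarith
  obtain ⟨α, hα, hαb⟩ := hS μ s (P x) hPx0
  refine ⟨α, hα, ?_⟩
  have h1 : ‖μ - Complex.I * α * s‖ * (1 / 2) ≤ b * (K₂ * s ^ 2) :=
    (mul_le_mul_of_nonneg_left hPx (norm_nonneg _)).trans (hαb.trans (by gcongr))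
  linarith

end SpectralInclusion

/-! ### The Newton-Puiseux theorem -/

section Puiseux

open Polynomial
open scoped ContDiff

/-- A family of monic polynomials of degree `n` whose coefficients are analytic at `0`. -/
def IsMonicAnalytic (n : ℕ) (p : ℂ → ℂ[X]) : Prop :=
  (∀ t, IsMonicOfDegree (p t) n) ∧ ∀ i, AnalyticAt ℂ (fun t => (p t).coeff i) 0

/-- The coordinates of a vector, extended by zero, as continuous linear functionals. -/
noncomputable def coordOrZero (n j : ℕ) : (Fin n → ℂ) →L[ℂ] ℂ :=
  if h : j < n then ContinuousLinearMap.proj ⟨j, h⟩ else 0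

/-- The polynomial of degree less than `n` with the given coefficients. -/
noncomputable def polyOfCoeffs {n : ℕ} (x : Fin n → ℂ) : ℂ[X] :=
  ∑ j ∈ Finset.range n, monomial j (coordOrZero n j x)

theorem coeff_polyOfCoeffs {n : ℕ} (x : Fin n → ℂ) (j : ℕ) :
    (polyOfCoeffs x).coeff j = coordOrZero n j x := by
  rw [polyOfCoeffs, finsetSum_coeff]
  simp only [coeff_monomial]
  rw [Finset.sum_ite_eq' (Finset.range n) j]
  split_ifs with h
  · rfl
  · rw [Finset.mem_range] at h
    simp [coordOrZero, h]

theorem degree_polyOfCoeffs_lt {n : ℕ} (x : Fin n → ℂ) : (polyOfCoeffs x).degree < n := by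
  rw [degree_lt_iff_coeff_zero]
  intro m hm
  rw [coeff_polyOfCoeffs]
  simp [coordOrZero, hm.not_gt]

theorem eq_zero_of_polyOfCoeffs_eq_zero {n : ℕ} {x : Fin n → ℂ} (h : polyOfCoeffs x = 0) :
    x = 0 := by
  funext j
  have := coeff_polyOfCoeffs x j
  rw [h] at this
  simpa [coordOrZero] using this.symm

theorem Polynomial.IsMonicOfDegree.add_polyOfCoeffs {n : ℕ} {a : ℂ[X]} (ha : IsMonicOfDegree a n)
    (x : Fin n → ℂ) : IsMonicOfDegree (a + polyOfCoeffs x) n := by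
  have hd := degree_polyOfCoeffs_lt x
  have h1 : a.degree = n := by
    rw [degree_eq_natDegree ha.ne_zero, ha.natDegree_eq]
  have h2 : (polyOfCoeffs x).degree < a.degree := by rwa [h1]
  refine ⟨?_, ?_⟩
  · rw [natDegree_add_eq_left_of_degree_lt h2, ha.natDegree_eq]
  · exact ha.monic.add_of_left h2

theorem isMonicAnalytic_add_polyOfCoeffs {n : ℕ} {a : ℂ[X]} (ha : IsMonicOfDegree a n)
    {x : ℂ → Fin n → ℂ} (hx : AnalyticAt ℂ x 0) :
    IsMonicAnalytic n (fun t => a + polyOfCoeffs (x t)) := by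
  refine ⟨fun t => ha.add_polyOfCoeffs _, fun i => ?_⟩
  simp only [coeff_add, coeff_polyOfCoeffs]
  exact analyticAt_const.add (((coordOrZero n i).analyticAt _).comp hx)

theorem Polynomial.IsMonicOfDegree.eq_of_coeff_eq {n : ℕ} {a b : ℂ[X]} (ha : IsMonicOfDegree a n)
    (hb : IsMonicOfDegree b n) (h : ∀ i < n, a.coeff i = b.coeff i) : a = b := by
  ext i
  rcases lt_or_ge i n with hi | hi
  · exact h i hi
  · exact ha.coeff_eq hb hi

/-- Hensel's lemma for analytic families: a coprime factorization at `0` extends nearby. -/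
theorem IsMonicAnalytic.exists_factorization {k l : ℕ} {p : ℂ → ℂ[X]}
    (hp : IsMonicAnalytic (k + l) p) {a b : ℂ[X]} (ha : IsMonicOfDegree a k)
    (hb : IsMonicOfDegree b l) (hab : IsCoprime a b) (h0 : p 0 = a * b) :
    ∃ A B : ℂ → ℂ[X], IsMonicAnalytic k A ∧ IsMonicAnalytic l B ∧
      ∀ᶠ t in 𝓝 0, p t = A t * B t := by
  let W := (Fin k → ℂ) × (Fin l → ℂ)
  let X₁ : ℕ → W →L[ℂ] ℂ := fun u => (coordOrZero k u).comp (ContinuousLinearMap.fst ℂ _ _)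
  let X₂ : ℕ → W →L[ℂ] ℂ := fun v => (coordOrZero l v).comp (ContinuousLinearMap.snd ℂ _ _)
  -- The coefficients of the product as a function of perturbations of the lower coefficients of `a`
  -- and `b`. The factorization comes from inverting `F` near `0`.
  let F : W → Fin (k + l) → ℂ := fun w i =>
    ∑ uv ∈ Finset.HasAntidiagonal.antidiagonal (i : ℕ),
      (a.coeff uv.1 + X₁ uv.1 w) * (b.coeff uv.2 + X₂ uv.2 w)
  have hF : ∀ w i, F w i = ((a + polyOfCoeffs w.1) * (b + polyOfCoeffs w.2)).coeff (i : ℕ) := by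
    intro w i
    simp only [F, coeff_mul, coeff_add, coeff_polyOfCoeffs]
    rfl
  let F' : W →L[ℂ] Fin (k + l) → ℂ := ContinuousLinearMap.pi fun i =>
    ∑ uv ∈ Finset.HasAntidiagonal.antidiagonal (i : ℕ),
      (a.coeff uv.1 • X₂ uv.2 + b.coeff uv.2 • X₁ uv.1)
  have hF' : ∀ w i, F' w i = (a * polyOfCoeffs w.2 + b * polyOfCoeffs w.1).coeff (i : ℕ) := by
    intro w i
    rw [mul_comm b]
    simp only [F', coeff_mul, coeff_add, coeff_polyOfCoeffs, ContinuousLinearMap.pi_apply,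
      sum_apply, add_apply, smul_apply, smul_eq_mul, ← Finset.sum_add_distrib]
    refine Finset.sum_congr rfl fun uv _ => ?_
    rw [mul_comm (b.coeff uv.2)]
    rfl
  have hderiv : HasFDerivAt F F' 0 := by
    rw [hasFDerivAt_pi']
    intro i
    have : HasFDerivAt (fun w => F w i)
        (∑ uv ∈ Finset.HasAntidiagonal.antidiagonal (i : ℕ),
          (a.coeff uv.1 • X₂ uv.2 + b.coeff uv.2 • X₁ uv.1)) 0 := by
      refine HasFDerivAt.fun_sum fun uv _ => ?_
      have := ((X₁ uv.1).hasFDerivAt (x := 0)).const_add (a.coeff uv.1) |>.mul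
        (((X₂ uv.2).hasFDerivAt (x := 0)).const_add (b.coeff uv.2))
      exact this.congr_fderiv (by simp)
    exact this
  -- The smoothness exponent `ω` means analytic, so the local inverse is analytic too.
  have hcont : ContDiff ℂ ω F := by
    rw [contDiff_pi]
    intro i
    refine ContDiff.sum fun uv _ => ?_
    exact (contDiff_const.add (X₁ uv.1).contDiff).mul (contDiff_const.add (X₂ uv.2).contDiff)
  -- The derivative is `(x, y) ↦ a y + b x`. If this vanishes, coprimality gives `a ∣ x`, and `deg x
  -- < deg a` gives `x = 0`, then `y = 0`.
  have hinj : Function.Injective F' := by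
    rw [← LinearMap.coe_coe, ← LinearMap.ker_eq_bot, LinearMap.ker_eq_bot']
    intro w hw
    have hdeg : (a * polyOfCoeffs w.2 + b * polyOfCoeffs w.1).degree
        < ((k + l : ℕ) : WithBot ℕ) := by
      have hda : a.degree = k := by rw [degree_eq_natDegree ha.ne_zero, ha.natDegree_eq]
      have hdb : b.degree = l := by rw [degree_eq_natDegree hb.ne_zero, hb.natDegree_eq]
      refine (degree_add_le _ _).trans_lt (max_lt ?_ ?_)
      · rw [degree_mul, hda, Nat.cast_add]
        exact WithBot.add_lt_add_left (by simp) (degree_polyOfCoeffs_lt _)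
      · rw [degree_mul, hdb, Nat.cast_add, add_comm]
        exact WithBot.add_lt_add_right (by simp) (degree_polyOfCoeffs_lt _)
    have hzero : a * polyOfCoeffs w.2 + b * polyOfCoeffs w.1 = 0 := by
      ext j
      rcases lt_or_ge j (k + l) with hj | hj
      · have := congrFun hw ⟨j, hj⟩
        rw [coeff_zero, ← hF' w ⟨j, hj⟩]
        exact this
      · exact coeff_eq_zero_of_degree_lt (hdeg.trans_le (by exact_mod_cast hj))
    have hdvd : a ∣ polyOfCoeffs w.1 := by
      refine hab.dvd_of_dvd_mul_left ⟨-polyOfCoeffs w.2, ?_⟩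
      linear_combination hzero
    have h1 : polyOfCoeffs w.1 = 0 := by
      refine eq_zero_of_dvd_of_degree_lt hdvd ?_
      rw [degree_eq_natDegree ha.ne_zero, ha.natDegree_eq]
      exact degree_polyOfCoeffs_lt _
    have h2 : polyOfCoeffs w.2 = 0 := by
      rw [h1, mul_zero, add_zero] at hzero
      exact (mul_eq_zero.1 hzero).resolve_left ha.ne_zero
    exact Prod.ext (eq_zero_of_polyOfCoeffs_eq_zero h1) (eq_zero_of_polyOfCoeffs_eq_zero h2)
  let e : W ≃L[ℂ] (Fin (k + l) → ℂ) :=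
    (LinearEquiv.ofInjectiveOfFinrankEq F'.toLinearMap hinj (by simp [W])).toContinuousLinearEquiv
  have he : (e : W →L[ℂ] Fin (k + l) → ℂ) = F' := by ext <;> rfl
  have hderiv' : HasFDerivAt F (e : W →L[ℂ] Fin (k + l) → ℂ) 0 := he ▸ hderiv
  have hstrict : HasStrictFDerivAt F (e : W →L[ℂ] Fin (k + l) → ℂ) 0 :=
    (hcont.contDiffAt).hasStrictFDerivAt' hderiv' (by simp)
  have hG : AnalyticAt ℂ (hcont.contDiffAt.localInverse hderiv' (by simp)) (F 0) :=
    (hcont.contDiffAt.to_localInverse hderiv' (by simp)).analyticAt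
  set G := hcont.contDiffAt.localInverse hderiv' (by simp) with hGdef
  let P : ℂ → Fin (k + l) → ℂ := fun t i => (p t).coeff i
  have hP : AnalyticAt ℂ P 0 := AnalyticAt.pi fun i => hp.2 i
  have hP0 : P 0 = F 0 := by
    funext i
    have hz : ∀ n : ℕ, polyOfCoeffs (0 : Fin n → ℂ) = 0 := fun n => by simp [polyOfCoeffs]
    rw [hF]
    simp only [P, h0, Prod.fst_zero, Prod.snd_zero, hz, add_zero]
  have hg : AnalyticAt ℂ (fun t => G (P t)) 0 := by
    rw [← hP0] at hG
    exact hG.comp hP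
  refine ⟨fun t => a + polyOfCoeffs (G (P t)).1, fun t => b + polyOfCoeffs (G (P t)).2,
    isMonicAnalytic_add_polyOfCoeffs ha (x := fun t => (G (P t)).1) (analyticAt_fst.comp hg),
    isMonicAnalytic_add_polyOfCoeffs hb (x := fun t => (G (P t)).2) (analyticAt_snd.comp hg), ?_⟩
  have hright : ∀ᶠ y in 𝓝 (F 0), F (G y) = y := hstrict.eventually_right_inverse
  rw [← hP0] at hright
  filter_upwards [hP.continuousAt.eventually hright] with t ht
  refine (hp.1 t).eq_of_coeff_eq ((ha.add_polyOfCoeffs _).mul (hb.add_polyOfCoeffs _))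
    fun i hi => ?_
  rw [← hF _ ⟨i, hi⟩, ht]

/-- The polynomials `p t` split into linear factors whose roots are analytic functions of a root
of `t`. -/
def HasPuiseuxRoots (p : ℂ → ℂ[X]) : Prop :=
  ∃ q : ℕ, 0 < q ∧ ∃ F : Multiset (ℂ → ℂ), (∀ f ∈ F, AnalyticAt ℂ f 0) ∧
    ∀ᶠ t in 𝓝 0, p (t ^ q) = (F.map fun f => X - C (f t)).prod

theorem tendsto_pow_zero {q : ℕ} (hq : 0 < q) : Tendsto (fun t : ℂ => t ^ q) (𝓝 0) (𝓝 0) := by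
  have := (continuous_pow (M := ℂ) q).tendsto 0
  rwa [zero_pow hq.ne'] at this

theorem AnalyticAt.comp_pow_zero {f : ℂ → ℂ} (hf : AnalyticAt ℂ f 0) {q : ℕ} (hq : 0 < q) :
    AnalyticAt ℂ (fun t => f (t ^ q)) 0 := by
  have h : AnalyticAt ℂ f ((0 : ℂ) ^ q) := by rwa [zero_pow hq.ne']
  exact AnalyticAt.comp (f := fun t : ℂ => t ^ q) h (by fun_prop)

theorem IsMonicAnalytic.comp_pow {n : ℕ} {p : ℂ → ℂ[X]} (hp : IsMonicAnalytic n p) {q : ℕ}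
    (hq : 0 < q) : IsMonicAnalytic n (fun t => p (t ^ q)) :=
  ⟨fun _ => hp.1 _, fun i => (hp.2 i).comp_pow_zero hq⟩

theorem HasPuiseuxRoots.of_comp_pow {p : ℂ → ℂ[X]} {v : ℕ} (hv : 0 < v)
    (h : HasPuiseuxRoots fun t => p (t ^ v)) : HasPuiseuxRoots p := by
  obtain ⟨q, hq, F, hF, h⟩ := h
  refine ⟨q * v, by positivity, F, hF, h.mono fun t ht => ?_⟩
  rw [pow_mul]; exact ht

/-- The product of the two ramification exponents serves as a common one: each branch is
reparametrized by the exponent of the other factor. -/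
theorem HasPuiseuxRoots.of_mul {p A B : ℂ → ℂ[X]} (hA : HasPuiseuxRoots A)
    (hB : HasPuiseuxRoots B) (h : ∀ᶠ t in 𝓝 0, p t = A t * B t) : HasPuiseuxRoots p := by
  obtain ⟨q₁, hq₁, F₁, hF₁, h₁⟩ := hA
  obtain ⟨q₂, hq₂, F₂, hF₂, h₂⟩ := hB
  have hq : 0 < q₁ * q₂ := by positivity
  refine ⟨q₁ * q₂, hq, F₁.map (fun f t => f (t ^ q₂)) + F₂.map (fun f t => f (t ^ q₁)), ?_, ?_⟩
  · intro f hf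
    rcases Multiset.mem_add.1 hf with hf | hf
    · obtain ⟨g, hg, rfl⟩ := Multiset.mem_map.1 hf
      exact (hF₁ g hg).comp_pow_zero hq₂
    · obtain ⟨g, hg, rfl⟩ := Multiset.mem_map.1 hf
      exact (hF₂ g hg).comp_pow_zero hq₁
  · filter_upwards [(tendsto_pow_zero hq).eventually h, (tendsto_pow_zero hq₂).eventually h₁,
      (tendsto_pow_zero hq₁).eventually h₂] with t ht ht₁ ht₂
    rw [ht, Multiset.map_add, Multiset.prod_add, Multiset.map_map, Multiset.map_map]
    congr 1
    · rw [mul_comm, pow_mul]; exact ht₁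
    · rw [pow_mul]; exact ht₂

theorem HasPuiseuxRoots.of_translate {p : ℂ → ℂ[X]} {c : ℂ → ℂ} (hc : AnalyticAt ℂ c 0)
    (h : HasPuiseuxRoots fun t => (p t).comp (X + C (c t))) : HasPuiseuxRoots p := by
  obtain ⟨q, hq, F, hF, h⟩ := h
  refine ⟨q, hq, F.map (fun f t => f t + c (t ^ q)), ?_, h.mono fun t ht => ?_⟩
  · intro f hf
    obtain ⟨g, hg, rfl⟩ := Multiset.mem_map.1 hf
    exact (hF g hg).add (hc.comp_pow_zero hq)
  · have h1 : p (t ^ q) = ((p (t ^ q)).comp (X + C (c (t ^ q)))).comp (X - C (c (t ^ q))) := by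
      rw [comp_assoc]; simp
    rw [h1, show (p (t ^ q)).comp (X + C (c (t ^ q))) = _ from ht, multiset_prod_comp,
      Multiset.map_map, Multiset.map_map]
    congr 1
    refine Multiset.map_congr rfl fun f _ => ?_
    simp only [Function.comp_apply, sub_comp, X_comp, C_comp, map_add]
    ring

theorem scaleRoots_prod_X_sub_C (s : Multiset ℂ) (r : ℂ) :
    scaleRoots (s.map fun a => X - C a).prod r = (s.map fun a => X - C (r * a)).prod := by
  induction s using Multiset.induction_on with
  | empty => simp
  | cons a s ih =>
    rw [Multiset.map_cons, Multiset.prod_cons, Multiset.map_cons, Multiset.prod_cons,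
      mul_scaleRoots_of_noZeroDivisors, ih]
    congr 1
    ext i
    rw [coeff_scaleRoots, natDegree_X_sub_C]
    rcases i with _ | _ | i
    · simp [mul_comm]
    · simp
    · simp [coeff_X]

theorem HasPuiseuxRoots.of_scaleRoots {p p' : ℂ → ℂ[X]} {u : ℕ} (h' : HasPuiseuxRoots p')
    (h : ∀ᶠ t in 𝓝 0, p t = scaleRoots (p' t) (t ^ u)) : HasPuiseuxRoots p := by
  obtain ⟨q, hq, F, hF, h'⟩ := h'
  refine ⟨q, hq, F.map (fun f t => (t ^ q) ^ u * f t), ?_, ?_⟩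
  · intro f hf
    obtain ⟨g, hg, rfl⟩ := Multiset.mem_map.1 hf
    exact AnalyticAt.mul (by fun_prop) (hF g hg)
  · filter_upwards [h', (tendsto_pow_zero hq).eventually h] with t ht' ht
    have h1 := scaleRoots_prod_X_sub_C (F.map fun f => f t) ((t ^ q) ^ u)
    rw [Multiset.map_map, Multiset.map_map] at h1
    rw [ht, ht', Multiset.map_map]
    exact h1

theorem Polynomial.IsMonicOfDegree.coeff_comp_X_add_C {n : ℕ} {p : ℂ[X]} (hp : IsMonicOfDegree p n) (c : ℂ)
    (i : ℕ) : (p.comp (X + C c)).coeff i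
      = ∑ m ∈ Finset.range (n + 1), p.coeff m * (c ^ (m - i) * m.choose i) := by
  conv_lhs => rw [p.as_sum_range_C_mul_X_pow' (n := n + 1) (by rw [hp.natDegree_eq]; omega)]
  rw [Polynomial.sum_comp, finsetSum_coeff]
  refine Finset.sum_congr rfl fun m _ => ?_
  rw [mul_comp, C_comp, pow_comp, X_comp, coeff_C_mul, coeff_X_add_C_pow]

theorem IsMonicAnalytic.translate {n : ℕ} {p : ℂ → ℂ[X]} (hp : IsMonicAnalytic n p) {c : ℂ → ℂ}
    (hc : AnalyticAt ℂ c 0) : IsMonicAnalytic n fun t => (p t).comp (X + C (c t)) := by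
  refine ⟨fun t => ?_, fun i => ?_⟩
  · simpa using (hp.1 t).comp (n := 1) one_ne_zero (isMonicOfDegree_X_add_one (c t))
  · simp only [(hp.1 _).coeff_comp_X_add_C]
    refine Finset.analyticAt_fun_sum _ fun m _ => ?_
    exact (hp.2 m).mul ((hc.pow _).mul analyticAt_const)

/-- A monic polynomial without the term of degree `n - 1` that is not `X ^ n` has a coprime
factorization into factors of smaller degree. -/
theorem Polynomial.IsMonicOfDegree.exists_coprime_factorization {n : ℕ} {p : ℂ[X]}
    (hp : IsMonicOfDegree p n) (hn : 0 < n) (hnext : p.coeff (n - 1) = 0) (hne : p ≠ X ^ n) :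
    ∃ (k l : ℕ) (a b : ℂ[X]), k < n ∧ l < n ∧ k + l = n ∧ IsMonicOfDegree a k ∧
      IsMonicOfDegree b l ∧ IsCoprime a b ∧ p = a * b := by
  obtain ⟨c, hc⟩ := IsAlgClosed.exists_root p (by
    rw [degree_eq_natDegree hp.ne_zero, hp.natDegree_eq]
    exact_mod_cast hn.ne')
  obtain ⟨b, hb, hbc⟩ := exists_eq_pow_rootMultiplicity_mul_and_not_dvd p hp.ne_zero c
  set k := p.rootMultiplicity c with hk
  have hk0 : 0 < k := (rootMultiplicity_pos hp.ne_zero).2 hc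
  have ha : IsMonicOfDegree ((X - C c) ^ k) k := by
    simpa using (isMonicOfDegree_X_sub_one c).pow k
  have hkn : k ≤ n := by
    have := natDegree_le_of_dvd ⟨b, hb⟩ hp.ne_zero
    rwa [ha.natDegree_eq, hp.natDegree_eq] at this
  have hb' : IsMonicOfDegree b (n - k) := by
    refine ha.of_mul_left ?_
    rwa [← hb, Nat.add_sub_cancel' hkn]
  refine ⟨k, n - k, (X - C c) ^ k, b, ?_, by omega, by omega, ha, hb', ?_, hb⟩
  -- If the root `c` had full multiplicity, then `p = (X - c) ^ n`, whose coefficient of degree `n -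
  -- 1` is `-n c`. Its vanishing would give `p = X ^ n`.
  · refine lt_of_le_of_ne hkn fun hkn' => ?_
    rw [hkn', Nat.sub_self, isMonicOfDegree_zero_iff] at hb'
    rw [hb', mul_one, hkn'] at hb
    have h1 : p.coeff (n - 1) = -c * n := by
      rw [hb, sub_eq_add_neg, ← C_neg, coeff_X_add_C_pow]
      rw [Nat.sub_sub_self (by omega), pow_one, Nat.choose_symm_of_eq_add (b := 1) (by omega),
        Nat.choose_one_right]
    rw [hnext] at h1
    have h2 : c = 0 := by
      have : (n : ℂ) ≠ 0 := by exact_mod_cast hn.ne'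
      simpa [this] using h1.symm
    exact hne (by rw [hb, h2, C_0, sub_zero])
  · exact IsCoprime.pow_left ((irreducible_X_sub_C c).coprime_iff_not_dvd.2 hbc)

/-- The substitution `t = τ ^ v` followed by division by the slope of the Newton polygon. -/
theorem IsMonicAnalytic.exists_scaleRoots {n : ℕ} {p : ℂ → ℂ[X]} (hp : IsMonicAnalytic n p)
    (hne : ∃ i < n, analyticOrderAt (fun t => (p t).coeff i) 0 ≠ ⊤) :
    ∃ (u v : ℕ) (p' : ℂ → ℂ[X]), 0 < v ∧ IsMonicAnalytic n p' ∧
      (∀ᶠ t in 𝓝 0, p (t ^ v) = scaleRoots (p' t) (t ^ u)) ∧ p' 0 ≠ X ^ n ∧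
      ∀ i < n, analyticOrderAt (fun t => (p t).coeff i) 0 = ⊤ → (p' 0).coeff i = 0 := by
  classical
  set a : ℕ → ℂ → ℂ := fun i t => (p t).coeff i with ha
  -- The index `i` realizes the least slope `ord(a j) / (n - j) = u / v` of the Newton polygon; the
  -- fraction need not be reduced. Minimality makes `a j (t ^ v)` divisible by `t ^ (u * (n - j))`,
  -- with a quotient that is nonzero at `0` when `j = i`.
  obtain ⟨i, hi, hmin⟩ := ((Finset.range n).filter fun j => analyticOrderAt (a j) 0 ≠ ⊤
    ).exists_min_image (fun j => (analyticOrderNatAt (a j) 0 : ℚ) / ((n - j : ℕ) : ℚ)) (by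
      obtain ⟨i, hi, h⟩ := hne
      exact ⟨i, by simp [hi, h, ha]⟩)
  rw [Finset.mem_filter, Finset.mem_range] at hi
  set u := analyticOrderNatAt (a i) 0 with hu
  set v := n - i with hv
  have hv0 : 0 < v := by omega
  have hb : ∀ j : Fin n, ∃ b : ℂ → ℂ, AnalyticAt ℂ b 0 ∧
      (∀ᶠ t in 𝓝 0, a j (t ^ v) = t ^ (u * (n - j)) * b t) ∧
      (analyticOrderAt (a j) 0 = ⊤ → b 0 = 0) ∧ ((j : ℕ) = i → b 0 ≠ 0) := by
    intro j
    by_cases hj : analyticOrderAt (a j) 0 = ⊤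
    · refine ⟨fun _ => 0, analyticAt_const, ?_, fun _ => rfl, fun h => absurd (h ▸ hj) hi.2⟩
      have := analyticOrderAt_eq_top.1 hj
      filter_upwards [(tendsto_pow_zero hv0).eventually this] with t ht
      rw [ht, mul_zero]
    · obtain ⟨g, hg, hg0, hga⟩ := (hp.2 j).analyticOrderAt_eq_natCast.1
        (Nat.cast_analyticOrderNatAt hj).symm
      set m := analyticOrderNatAt (a j) 0 with hm
      have hle : u * (n - j) ≤ v * m := by
        have h1 := hmin j (by simp [hj])
        have h2 : (0 : ℚ) < ((n - j : ℕ) : ℚ) := by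
          have : 0 < n - (j : ℕ) := by omega
          exact_mod_cast this
        have h3 : (0 : ℚ) < ((n - i : ℕ) : ℚ) := by exact_mod_cast hv0
        rw [div_le_div_iff₀ h3 h2] at h1
        rw [mul_comm v]
        exact_mod_cast h1
      refine ⟨fun t => t ^ (v * m - u * (n - j)) * g (t ^ v),
        AnalyticAt.mul (by fun_prop) (hg.comp_pow_zero hv0), ?_, fun h => absurd h hj, ?_⟩
      · filter_upwards [(tendsto_pow_zero hv0).eventually hga] with t ht
        rw [show a j (t ^ v) = _ from ht, sub_zero, smul_eq_mul, ← mul_assoc, ← pow_add,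
          Nat.add_sub_cancel' hle, pow_mul]
      · intro hji
        have : v * m - u * (n - j) = 0 := by
          rw [hm, hu, hji, ← hv, mul_comm, Nat.sub_self]
        simp only [this]
        simpa [hv0.ne'] using hg0
  choose b hban hbeq hbtop hbi using hb
  have hban' : AnalyticAt ℂ (fun t (j : Fin n) => b j t) 0 := AnalyticAt.pi hban
  have hcoeff : ∀ t (j : Fin n),
      (X ^ n + polyOfCoeffs (fun j : Fin n => b j t)).coeff (j : ℕ) = b j t := by
    intro t j
    rw [coeff_add, coeff_polyOfCoeffs, coeff_X_pow, if_neg j.2.ne]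
    simp [coordOrZero]
  have hmono := isMonicAnalytic_add_polyOfCoeffs (isMonicOfDegree_X_pow ℂ n) hban'
  refine ⟨u, v, fun t => X ^ n + polyOfCoeffs (fun j => b j t), hv0, hmono, ?_, ?_, ?_⟩
  · filter_upwards [eventually_all.2 hbeq] with t ht
    have hs : IsMonicOfDegree
        (scaleRoots (X ^ n + polyOfCoeffs (fun j : Fin n => b j t)) (t ^ u)) n :=
      ⟨by rw [natDegree_scaleRoots, (hmono.1 t).natDegree_eq],
        (monic_scaleRoots_iff _).2 (hmono.1 t).monic⟩
    refine (hp.1 _).eq_of_coeff_eq hs fun j hj => ?_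
    rw [coeff_scaleRoots, hcoeff t ⟨j, hj⟩, (hmono.1 t).natDegree_eq, ← pow_mul, mul_comm]
    exact ht ⟨j, hj⟩
  · intro h
    have h1 := hcoeff 0 ⟨i, hi.1⟩
    rw [show X ^ n + polyOfCoeffs (fun j : Fin n => b j 0) = X ^ n from h, coeff_X_pow,
      if_neg hi.1.ne] at h1
    exact hbi ⟨i, hi.1⟩ rfl h1.symm
  · intro j hj htop
    exact (hcoeff 0 ⟨j, hj⟩).trans (hbtop ⟨j, hj⟩ htop)

/-- The Newton-Puiseux theorem for monic polynomials with convergent coefficients. -/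
theorem IsMonicAnalytic.hasPuiseuxRoots {n : ℕ} {p : ℂ → ℂ[X]} (hp : IsMonicAnalytic n p) :
    HasPuiseuxRoots p := by
  induction n using Nat.strong_induction_on generalizing p with
  | _ n ih =>
  rcases Nat.eq_zero_or_pos n with rfl | hn
  · refine ⟨1, one_pos, 0, by simp, Eventually.of_forall fun t => ?_⟩
    rw [isMonicOfDegree_zero_iff.1 (hp.1 (t ^ 1)), Multiset.map_zero, Multiset.prod_zero]
  have hnC : (n : ℂ) ≠ 0 := by exact_mod_cast hn.ne'
  -- The mean of the roots. Translating by it removes the coefficient of degree `n - 1`, so that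
  -- after rescaling the polynomial at `0` has at least two distinct roots and the degree drops.
  set c : ℂ → ℂ := fun t => -(p t).coeff (n - 1) / n with hc
  have hcan : AnalyticAt ℂ c 0 := (hp.2 (n - 1)).neg.div_const
  refine HasPuiseuxRoots.of_translate hcan ?_
  have hp₁ := hp.translate hcan
  set p₁ : ℂ → ℂ[X] := fun t => (p t).comp (X + C (c t)) with hp₁def
  have hnext : ∀ t, (p₁ t).coeff (n - 1) = 0 := by
    intro t
    obtain ⟨m, rfl⟩ : ∃ m, n = m + 1 := ⟨n - 1, by omega⟩
    rw [hp₁def]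
    simp only
    rw [(hp.1 t).coeff_comp_X_add_C, Finset.sum_range_succ, Finset.sum_range_succ,
      Finset.sum_eq_zero]
    · have h1 : (p t).coeff (m + 1) = 1 := by
        have := (hp.1 t).leadingCoeff_eq
        rwa [leadingCoeff, (hp.1 t).natDegree_eq] at this
      rw [h1]
      simp only [Nat.add_sub_cancel, Nat.sub_self, pow_zero, Nat.choose_self, hc,
        Nat.add_sub_cancel_left, pow_one, Nat.choose_succ_self_right]
      field_simp
      push_cast
      ring
    · intro j hj
      rw [Finset.mem_range] at hj
      rw [Nat.add_sub_cancel, Nat.choose_eq_zero_of_lt hj]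
      simp
  by_cases hne : ∃ i < n, analyticOrderAt (fun t => (p₁ t).coeff i) 0 ≠ ⊤
  · obtain ⟨u, v, p₂, hv, hp₂, heq, hX, htop⟩ := hp₁.exists_scaleRoots hne
    refine HasPuiseuxRoots.of_comp_pow hv (HasPuiseuxRoots.of_scaleRoots ?_ heq)
    obtain ⟨k, l, a, b, hk, hl, hkl, ha, hb, hab, h0⟩ :=
      (hp₂.1 0).exists_coprime_factorization hn
        (htop (n - 1) (by omega) (by simp [hnext, analyticOrderAt_eq_top])) hX
    subst hkl
    obtain ⟨A, B, hA, hB, hAB⟩ := hp₂.exists_factorization ha hb hab h0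
    exact (ih k hk hA).of_mul (ih l hl hB) hAB
  · push Not at hne
    refine ⟨1, one_pos, Multiset.replicate n (fun _ => 0), fun f hf => ?_, ?_⟩
    · rw [Multiset.eq_of_mem_replicate hf]; exact analyticAt_const
    · have : ∀ i : Fin n, ∀ᶠ t in 𝓝 0, (p₁ t).coeff i = 0 := fun i =>
        analyticOrderAt_eq_top.1 (hne i i.2)
      filter_upwards [eventually_all.2 this] with t ht
      rw [pow_one]
      simp only [Multiset.map_replicate, Multiset.prod_replicate, C_0, sub_zero]
      refine (hp₁.1 t).eq_of_coeff_eq (isMonicOfDegree_X_pow ℂ n) fun i hi => ?_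
      rw [ht ⟨i, hi⟩, coeff_X_pow, if_neg hi.ne]

end Puiseux

/-! ### Complexification, characteristic polynomials and orders of vanishing -/

section AnalyticFamilies

/-- An analytic function of a real variable extends to an analytic function of a complex one. -/
theorem AnalyticAt.exists_complex_extension {E : Type*} [NormedAddCommGroup E] [NormedSpace ℂ E]
    [CompleteSpace E] {f : ℝ → E} (hf : AnalyticAt ℝ f 0) :
    ∃ g : ℂ → E, AnalyticAt ℂ g 0 ∧ ∀ᶠ s : ℝ in 𝓝 0, g s = f s := by
  obtain ⟨p, hp⟩ := hf
  -- The same Taylor coefficients over `ℂ`: the norms of the terms, hence the radius of convergence,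
  -- are unchanged.
  let p' : FormalMultilinearSeries ℂ ℂ E := fun n =>
    ContinuousMultilinearMap.mkPiRing ℂ (Fin n) (p.coeff n)
  have hcoeff : ∀ n, p'.coeff n = p.coeff n := fun n => by
    change ContinuousMultilinearMap.mkPiRing ℂ (Fin n) (p.coeff n) 1 = p.coeff n
    simp only [ContinuousMultilinearMap.mkPiRing_apply, Pi.one_apply, Finset.prod_const_one,
      one_smul]
  have hnorm : ∀ n, ‖p' n‖₊ = ‖p n‖₊ := fun n => by
    rw [← NNReal.coe_inj, coe_nnnorm, coe_nnnorm, FormalMultilinearSeries.norm_apply_eq_norm_coef,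
      FormalMultilinearSeries.norm_apply_eq_norm_coef, hcoeff]
  have hrad : p'.radius = p.radius := by
    simp only [FormalMultilinearSeries.radius, ← coe_nnnorm, hnorm]
  have hpos : 0 < p'.radius := hrad ▸ hp.radius_pos
  have hp' : HasFPowerSeriesAt p'.sum p' 0 := (p'.hasFPowerSeriesOnBall hpos).hasFPowerSeriesAt
  refine ⟨p'.sum, ⟨p', hp'⟩, ?_⟩
  have htend : Tendsto (fun s : ℝ => (s : ℂ)) (𝓝 0) (𝓝 0) := by
    simpa using Complex.continuous_ofReal.tendsto 0
  filter_upwards [hasFPowerSeriesAt_iff.1 hp, htend.eventually (hasFPowerSeriesAt_iff.1 hp')]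
    with s hs hs'
  simp only [zero_add, hcoeff] at hs hs'
  refine hs'.unique ?_
  convert! hs using 2 with n
  rw [← Complex.ofReal_pow, Complex.coe_smul]

theorem AnalyticAt.exists_isBigO_sq {E : Type*} [NormedAddCommGroup E] [NormedSpace ℝ E]
    {f : ℝ → E} (hf : AnalyticAt ℝ f 0) :
    ∃ D : E, (fun s : ℝ => f s - (f 0 + s • D)) =O[𝓝 0] (fun s : ℝ => s ^ 2) := by
  obtain ⟨p, hp⟩ := hf
  refine ⟨p.coeff 1, ?_⟩
  have h := hp.isBigO_sub_partialSum_pow 2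
  refine (h.congr_left fun s => ?_).trans (isBigO_of_le _ fun s => by simp)
  rw [FormalMultilinearSeries.partialSum, Finset.sum_range_succ, Finset.sum_range_one,
    FormalMultilinearSeries.apply_eq_pow_smul_coeff, FormalMultilinearSeries.apply_eq_pow_smul_coeff,
    show p.coeff 0 = f 0 from hp.coeff_zero 1, pow_zero, one_smul, pow_one, zero_add]

open Polynomial in
-- The coefficients of the characteristic polynomial are polynomials in the coordinates of the
-- operator.
theorem isMonicAnalytic_charpoly {E : Type*} [NormedAddCommGroup E] [NormedSpace ℂ E]
    [FiniteDimensional ℂ E] {A : ℂ → E →L[ℂ] E} (hA : AnalyticAt ℂ A 0) :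
    IsMonicAnalytic (Module.finrank ℂ E) fun t => (A t).toLinearMap.charpoly := by
  refine ⟨fun t => ⟨LinearMap.charpoly_natDegree _, LinearMap.charpoly_monic _⟩, fun i => ?_⟩
  have : FiniteDimensional ℂ (E →L[ℂ] E) := inferInstance
  let b := Module.finBasis ℂ (E →L[ℂ] E)
  let φ : (E →L[ℂ] E) →ₗ[ℂ] Module.End ℂ E := ContinuousLinearMap.coeLM ℂ
  have h : ∀ t, (A t).toLinearMap.charpoly.coeff i
      = MvPolynomial.aeval (b.repr (A t)) ((φ.polyCharpoly b).coeff i) := fun t => by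
    rw [MvPolynomial.aeval_eq_eval]
    exact (φ.polyCharpoly_coeff_eval b (A t) i).symm
  simp only [h]
  refine AnalyticAt.aeval_mvPolynomial (fun j => ?_) _
  exact ((LinearMap.toContinuousLinearMap (b.coord j)).analyticAt _).comp hA

/-- An analytic function that is `O(t ^ N)` along a sequence `t → 0+` is divisible by `τ ^ N`. -/
theorem AnalyticAt.exists_eq_pow_mul_of_frequently_le {F : ℂ → ℂ} (hF : AnalyticAt ℂ F 0) {K : ℝ}
    {N : ℕ} (h : ∃ᶠ t : ℝ in 𝓝[>] 0, ‖F t‖ ≤ K * t ^ N) :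
    ∃ g : ℂ → ℂ, AnalyticAt ℂ g 0 ∧ ∀ᶠ τ in 𝓝 0, F τ = τ ^ N * g τ := by
  by_cases htop : analyticOrderAt F 0 = ⊤
  · refine ⟨fun _ => 0, analyticAt_const, ?_⟩
    simpa using analyticOrderAt_eq_top.1 htop
  obtain ⟨g, hg, hg0, hFg⟩ := hF.analyticOrderAt_eq_natCast.1
    (Nat.cast_analyticOrderNatAt htop).symm
  set m := analyticOrderNatAt F 0
  simp only [sub_zero, smul_eq_mul] at hFg
  rcases le_or_gt N m with hNm | hNm
  · refine ⟨fun τ => τ ^ (m - N) * g τ, AnalyticAt.mul (by fun_prop) hg, hFg.mono fun τ hτ => ?_⟩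
    rw [hτ, ← mul_assoc, ← pow_add, Nat.add_sub_cancel' hNm]
  -- If the order `m` were below `N`, dividing by `t ^ m` would give `‖g t‖ ≤ K * t ^ (N - m)` for
  -- arbitrarily small `t`, against `g 0 ≠ 0`.
  · exfalso
    have htend : Tendsto (fun t : ℝ => (t : ℂ)) (𝓝[>] 0) (𝓝 0) := by
      have : Tendsto (fun s : ℝ => (s : ℂ)) (𝓝 0) (𝓝 0) := by
        simpa using Complex.continuous_ofReal.tendsto 0
      exact this.mono_left nhdsWithin_le_nhds
    have h1 : Tendsto (fun t : ℝ => ‖g t‖ - K * t ^ (N - m)) (𝓝[>] 0) (𝓝 (‖g 0‖ - K * 0)) := by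
      refine ((hg.continuousAt.tendsto.comp htend).norm).sub (Tendsto.const_mul K ?_)
      have : Tendsto (fun t : ℝ => t ^ (N - m)) (𝓝 0) (𝓝 (0 ^ (N - m))) :=
        (continuous_pow _).tendsto 0
      rw [zero_pow (by omega)] at this
      exact this.mono_left nhdsWithin_le_nhds
    rw [mul_zero, sub_zero] at h1
    obtain ⟨t, ht, ht1, ht2, ht0 : 0 < t⟩ := (h.and_eventually ((h1.eventually
      (lt_mem_nhds (norm_pos_iff.2 hg0))).and ((htend.eventually hFg).and
        self_mem_nhdsWithin))).exists
    rw [ht2, norm_mul, norm_pow, Complex.norm_real, Real.norm_of_nonneg ht0.le,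
      ← Nat.add_sub_cancel' hNm.le, pow_add] at ht
    have h2 : t ^ m * ‖g t‖ ≤ t ^ m * (K * t ^ (N - m)) := by linarith
    have h3 := le_of_mul_le_mul_left h2 (by positivity)
    linarith

end AnalyticFamilies

/-! ### Differentiability of functions of a `q`-th root -/

section SignedRoot

/-- A `q`-th root on the real line, `|s| ^ (1/q)` for `s ≥ 0` and `ζ |s| ^ (1/q)` for `s < 0`,
where `ζ ^ q = -1`. -/
noncomputable def signedRoot (q : ℕ) (ζ : ℂ) (s : ℝ) : ℂ :=
  if 0 ≤ s then ((s ^ ((q : ℝ)⁻¹) : ℝ) : ℂ) else ζ * (((-s) ^ ((q : ℝ)⁻¹) : ℝ) : ℂ)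

variable {q : ℕ} {ζ : ℂ}

theorem signedRoot_pow (hq : 0 < q) (hζ : ζ ^ q = -1) (s : ℝ) : signedRoot q ζ s ^ q = s := by
  unfold signedRoot
  split_ifs with h
  · rw [← Complex.ofReal_pow, Real.rpow_inv_natCast_pow h hq.ne']
  · rw [mul_pow, hζ, ← Complex.ofReal_pow, Real.rpow_inv_natCast_pow (by linarith) hq.ne']
    push_cast; ring

theorem signedRoot_zero (hq : 0 < q) : signedRoot q ζ 0 = 0 := by
  have : (q : ℝ)⁻¹ ≠ 0 := by positivity
  simp [signedRoot, Real.zero_rpow this]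

theorem signedRoot_of_pos {s : ℝ} (hs : 0 < s) :
    signedRoot q ζ s = ((s ^ ((q : ℝ)⁻¹) : ℝ) : ℂ) := if_pos hs.le

theorem hasDerivAt_signedRoot {s : ℝ} (hs : s ≠ 0) :
    HasDerivAt (signedRoot q ζ) (signedRoot q ζ s / (q * s)) s := by
  have key : ∀ x : ℝ, 0 < x → HasDerivAt (fun x : ℝ => ((x ^ ((q : ℝ)⁻¹) : ℝ) : ℂ))
      (((x ^ ((q : ℝ)⁻¹) : ℝ) : ℂ) / (q * x)) x := by
    intro x hx
    have h := (Real.hasDerivAt_rpow_const (x := x) (p := (q : ℝ)⁻¹) (Or.inl hx.ne')).ofReal_comp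
    convert! h using 1
    rw [Real.rpow_sub_one hx.ne']
    push_cast
    field_simp
  rcases hs.lt_or_gt with h | h
  · have h1 := ((key (-s) (by linarith)).scomp s (hasDerivAt_neg s)).const_mul ζ
    have h2 : HasDerivAt (signedRoot q ζ) _ s := h1.congr_of_eventuallyEq (by
      filter_upwards [Iio_mem_nhds h] with x hx
      simp [signedRoot, not_le.2 (Set.mem_Iio.1 hx)])
    refine h2.congr_deriv ?_
    rw [signedRoot, if_neg h.not_ge]
    simp only [neg_smul, one_smul]
    push_cast
    rw [mul_neg (q : ℂ), div_neg]
    ring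
  · have h2 : HasDerivAt (signedRoot q ζ) _ s := (key s h).congr_of_eventuallyEq (by
      filter_upwards [Ioi_mem_nhds h] with x hx
      exact signedRoot_of_pos hx)
    exact h2.congr_deriv (by rw [signedRoot_of_pos h])

theorem continuousAt_signedRoot_zero (hq : 0 < q) (hζ : ζ ^ q = -1) :
    ContinuousAt (signedRoot q ζ) 0 := by
  have hq' : 0 < (q : ℝ)⁻¹ := by positivity
  have hζn : ‖ζ‖ = 1 := by
    have : ‖ζ‖ ^ q = 1 := by rw [← norm_pow, hζ]; simp
    exact (pow_eq_one_iff_of_nonneg (norm_nonneg _) hq.ne').1 this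
  rw [ContinuousAt, signedRoot_zero hq, tendsto_zero_iff_norm_tendsto_zero]
  have h1 : ∀ s, ‖signedRoot q ζ s‖ = |s| ^ ((q : ℝ)⁻¹) := by
    intro s
    unfold signedRoot
    split_ifs with h
    · rw [Complex.norm_real, abs_of_nonneg h, Real.norm_of_nonneg (by positivity)]
    · have : 0 ≤ -s := by linarith
      rw [norm_mul, hζn, one_mul, Complex.norm_real, Real.norm_of_nonneg (by positivity),
        abs_of_neg (not_le.1 h)]
  simp only [h1]
  have h2 : ContinuousAt (fun s : ℝ => |s| ^ ((q : ℝ)⁻¹)) 0 :=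
    (continuous_abs.continuousAt).rpow_const (Or.inr hq'.le)
  simpa [ContinuousAt, Real.zero_rpow hq'.ne'] using h2

theorem tendsto_signedRoot_zero (hq : 0 < q) (hζ : ζ ^ q = -1) :
    Tendsto (signedRoot q ζ) (𝓝 0) (𝓝 0) := by
  have := continuousAt_signedRoot_zero hq hζ
  rwa [ContinuousAt, signedRoot_zero hq] at this

theorem continuous_signedRoot (hq : 0 < q) (hζ : ζ ^ q = -1) : Continuous (signedRoot q ζ) := by
  rw [continuous_iff_continuousAt]
  intro s
  rcases eq_or_ne s 0 with rfl | hs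
  · exact continuousAt_signedRoot_zero hq hζ
  · exact (hasDerivAt_signedRoot hs).continuousAt

/-- Since `dτ/ds = τ / (q s)` for `τ = s ^ (1/q)`, differentiation keeps the shape of a power of `s`
times an analytic function of `τ` and lowers the power by one. At `s = 0` the difference quotient is
itself `s ^ k * g τ`. -/
theorem hasDerivAt_pow_mul_comp_signedRoot (hq : 0 < q) (hζ : ζ ^ q = -1) {g : ℂ → ℂ}
    (hg : AnalyticAt ℂ g 0) (k : ℕ) :
    ∀ᶠ s : ℝ in 𝓝 0, HasDerivAt (fun s : ℝ => (s : ℂ) ^ (k + 1) * g (signedRoot q ζ s))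
      ((s : ℂ) ^ k * ((k + 1) * g (signedRoot q ζ s)
        + signedRoot q ζ s * deriv g (signedRoot q ζ s) / q)) s := by
  have hqC : (q : ℂ) ≠ 0 := by exact_mod_cast hq.ne'
  filter_upwards [(tendsto_signedRoot_zero hq hζ).eventually hg.eventually_analyticAt] with s hs
  have hid : HasDerivAt (fun s : ℝ => (s : ℂ)) 1 s := Complex.ofRealCLM.hasDerivAt
  rcases eq_or_ne s 0 with rfl | hs0
  · have hcont : ContinuousAt (fun s : ℝ => (s : ℂ) ^ k * g (signedRoot q ζ s)) 0 := by
      refine ContinuousAt.mul (by fun_prop) ?_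
      exact ContinuousAt.comp hs.continuousAt (continuousAt_signedRoot_zero hq hζ)
    rw [hasDerivAt_iff_tendsto_slope]
    have hval : ((0 : ℝ) : ℂ) ^ k * ((k + 1) * g (signedRoot q ζ 0)
        + signedRoot q ζ 0 * deriv g (signedRoot q ζ 0) / q)
        = ((0 : ℝ) : ℂ) ^ k * g (signedRoot q ζ 0) := by
      rcases k with _ | k
      · simp [signedRoot_zero hq]
      · simp
    rw [hval]
    refine (hcont.tendsto.mono_left nhdsWithin_le_nhds).congr' ?_
    filter_upwards [self_mem_nhdsWithin] with x hx
    have hxC : (x : ℂ) ≠ 0 := by exact_mod_cast hx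
    rw [slope_def_module]
    simp only [sub_zero, Complex.ofReal_zero, zero_pow (Nat.succ_ne_zero k), zero_mul]
    rw [← Complex.coe_smul, smul_eq_mul, Complex.ofReal_inv, pow_succ]
    field_simp
  · have hsC : (s : ℂ) ≠ 0 := by exact_mod_cast hs0
    have h1 : HasDerivAt (fun s : ℝ => g (signedRoot q ζ s))
        (deriv g (signedRoot q ζ s) * (signedRoot q ζ s / (q * s))) s :=
      HasDerivAt.comp s hs.differentiableAt.hasDerivAt (hasDerivAt_signedRoot hs0)
    refine ((hid.pow (k + 1)).mul h1).congr_deriv ?_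
    simp only [Nat.add_sub_cancel, Pi.pow_apply, Nat.cast_add, Nat.cast_one, mul_one]
    rw [pow_succ]
    field_simp

theorem contDiffOn_two_of_hasDerivAt {U : Set ℝ} (hU : IsOpen U) {F F₁ F₂ : ℝ → ℂ}
    (h₁ : ∀ s ∈ U, HasDerivAt F (F₁ s) s) (h₂ : ∀ s ∈ U, HasDerivAt F₁ (F₂ s) s)
    (h₃ : ContinuousOn F₂ U) : ContDiffOn ℝ 2 F U := by
  have e : (2 : WithTop ℕ∞) = 1 + 1 := by norm_num
  have h1 : ContDiffOn ℝ 1 F₁ U := by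
    rw [← zero_add (1 : WithTop ℕ∞), contDiffOn_succ_iff_deriv_of_isOpen hU]
    refine ⟨fun s hs => (h₂ s hs).differentiableAt.differentiableWithinAt, by simp, ?_⟩
    rw [contDiffOn_zero]
    exact h₃.congr fun s hs => (h₂ s hs).deriv
  rw [e, contDiffOn_succ_iff_deriv_of_isOpen hU]
  exact ⟨fun s hs => (h₁ s hs).differentiableAt.differentiableWithinAt, by simp,
    h1.congr fun s hs => (h₁ s hs).deriv⟩

/-- The function `s ^ 2 g(s ^ (1/q))` is twice continuously differentiable near `0`. -/
theorem exists_contDiffOn_sq_mul_comp_signedRoot (hq : 0 < q) (hζ : ζ ^ q = -1) {g : ℂ → ℂ}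
    (hg : AnalyticAt ℂ g 0) : ∀ᶠ ε : ℝ in 𝓝[>] 0,
      ContDiffOn ℝ 2 (fun s : ℝ => (s : ℂ) ^ 2 * g (signedRoot q ζ s)) (Set.Ioo (-ε) ε) := by
  -- `g₁` and `g₂` are the analytic factors after one and two derivatives. By then both powers of
  -- `s` are spent, and `g₂` of the root is still continuous.
  set g₁ : ℂ → ℂ := fun τ => (((1 : ℕ) : ℂ) + 1) * g τ + τ * deriv g τ / q with hg₁
  have hg₁a : AnalyticAt ℂ g₁ 0 :=
    (analyticAt_const.mul hg).add ((analyticAt_id.mul hg.deriv).div_const)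
  set g₂ : ℂ → ℂ := fun τ => (((0 : ℕ) : ℂ) + 1) * g₁ τ + τ * deriv g₁ τ / q with hg₂
  have hg₂a : AnalyticAt ℂ g₂ 0 :=
    (analyticAt_const.mul hg₁a).add ((analyticAt_id.mul hg₁a.deriv).div_const)
  have h1 := hasDerivAt_pow_mul_comp_signedRoot hq hζ hg 1
  have h2 := hasDerivAt_pow_mul_comp_signedRoot hq hζ hg₁a 0
  have h3 := (tendsto_signedRoot_zero hq hζ).eventually hg₂a.eventually_analyticAt
  obtain ⟨δ, hδ, hball⟩ := Metric.eventually_nhds_iff.1 (h1.and (h2.and h3))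
  filter_upwards [Ioo_mem_nhdsGT hδ] with ε hε
  have hmem : ∀ s ∈ Set.Ioo (-ε) ε, dist s 0 < δ := fun s hs => by
    rw [Real.dist_eq, sub_zero]
    exact (abs_lt.2 hs).trans hε.2
  refine contDiffOn_two_of_hasDerivAt isOpen_Ioo
    (F₁ := fun s : ℝ => (s : ℂ) ^ (0 + 1) * g₁ (signedRoot q ζ s))
    (F₂ := fun s : ℝ => g₂ (signedRoot q ζ s)) (fun s hs => ?_) (fun s hs => ?_) fun s hs => ?_
  · simpa [hg₁] using (hball (hmem s hs)).1
  · have := (hball (hmem s hs)).2.1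
    rw [pow_zero, one_mul] at this
    exact this
  · have := (hball (hmem s hs)).2.2.continuousAt
    exact (ContinuousAt.comp (f := signedRoot q ζ) this
      (continuous_signedRoot hq hζ).continuousAt).continuousWithinAt

end SignedRoot

/-! ### Eigenvalue branches and the second-order expansion -/

section Branches

theorem exists_fin_enumeration {α : Type*} {n : ℕ} (F : Multiset α) (h : F.card = n) :
    ∃ φ : Fin n → α, Finset.univ.val.map φ = F := by
  obtain ⟨l, rfl⟩ : ∃ l : List α, (l : Multiset α) = F := Quotient.exists_rep F
  rw [Multiset.coe_card] at h
  subst h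
  exact ⟨l.get, by rw [Fin.univ_val_map, List.ofFn_get]⟩

/-- An analytic branch that stays within `O(t ^ (2 q))` of finitely many functions
`z₀ + i α t ^ q` agrees with one of them to that order. -/
theorem AnalyticAt.exists_eq_add_pow_mul {f : ℂ → ℂ} (hf : AnalyticAt ℂ f 0) {z₀ : ℂ} {q : ℕ}
    {S : Finset ℝ} {K : ℝ}
    (h : ∀ᶠ t : ℝ in 𝓝[>] 0, ∃ α ∈ S,
      ‖f t - z₀ - Complex.I * α * ((t ^ q : ℝ) : ℂ)‖ ≤ K * (t ^ q) ^ 2) :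
    ∃ α ∈ S, ∃ g : ℂ → ℂ, AnalyticAt ℂ g 0 ∧
      ∀ᶠ τ in 𝓝 0, f τ = z₀ + Complex.I * (α : ℝ) * τ ^ q + (τ ^ q) ^ 2 * g τ := by
  -- Pigeonhole: `α` may vary with `t`, but some element of the finite set `S` occurs for
  -- arbitrarily small `t`, which suffices to bound an order of vanishing.
  obtain ⟨α, hα, hfreq⟩ : ∃ α ∈ S, ∃ᶠ t : ℝ in 𝓝[>] 0,
      ‖f t - z₀ - Complex.I * α * ((t ^ q : ℝ) : ℂ)‖ ≤ K * (t ^ q) ^ 2 := by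
    by_contra! hcon
    have h1 : ∀ α ∈ S, ∀ᶠ t : ℝ in 𝓝[>] 0,
        ¬ ‖f t - z₀ - Complex.I * α * ((t ^ q : ℝ) : ℂ)‖ ≤ K * (t ^ q) ^ 2 := fun α hα => by
      have := hcon α hα
      simpa only [not_le] using this
    obtain ⟨t, ⟨α, hα, hle⟩, hnot⟩ := (h.and ((Finset.eventually_all S).2 h1)).exists
    exact hnot α hα hle
  refine ⟨α, hα, ?_⟩
  have hF : AnalyticAt ℂ (fun τ => f τ - z₀ - Complex.I * α * τ ^ q) 0 :=
    (hf.sub analyticAt_const).sub (analyticAt_const.mul (analyticAt_id.pow q))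
  obtain ⟨g, hg, hfg⟩ := hF.exists_eq_pow_mul_of_frequently_le (K := K) (N := q * 2)
    (hfreq.mono fun t ht => by
      rw [pow_mul]
      convert! ht using 3
      push_cast; rfl)
  refine ⟨g, hg, hfg.mono fun τ hτ => ?_⟩
  rw [← pow_mul]
  linear_combination hτ

theorem eventually_mem_ball_iff {f : ℂ → ℂ} (hf : ContinuousAt f 0) (z₀ : ℂ) :
    ∀ᶠ r : ℝ in 𝓝[>] 0, ∀ᶠ τ : ℂ in 𝓝 0, (f τ ∈ Metric.ball z₀ r ↔ f 0 = z₀) := by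
  by_cases h : f 0 = z₀
  · filter_upwards [self_mem_nhdsWithin] with r (hr : 0 < r)
    have h1 : Metric.ball z₀ r ∈ 𝓝 (f 0) := by rw [h]; exact Metric.ball_mem_nhds _ hr
    filter_upwards [hf.eventually h1] with τ hτ
    exact ⟨fun _ => h, fun _ => hτ⟩
  · filter_upwards [Ioo_mem_nhdsGT (dist_pos.2 h)] with r hr
    have h1 : Tendsto (fun τ => dist (f τ) z₀) (𝓝 0) (𝓝 (dist (f 0) z₀)) :=
      hf.tendsto.dist tendsto_const_nhds
    filter_upwards [h1.eventually (lt_mem_nhds hr.2)] with τ hτ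
    exact ⟨fun h' => absurd h' hτ.not_gt, fun h' => absurd h' h⟩

/-- A small disc separates the branches starting at `z₀` from the others, so that counting
eigenvalues in it amounts to selecting branches by their value at `0`. -/
theorem eventually_forall_mem_ball_iff {F : Multiset (ℂ → ℂ)} (hF : ∀ f ∈ F, AnalyticAt ℂ f 0)
    (z₀ : ℂ) : ∀ᶠ r : ℝ in 𝓝[>] 0, ∀ᶠ τ : ℂ in 𝓝 0, ∀ f ∈ F,
      (f τ ∈ Metric.ball z₀ r ↔ f 0 = z₀) := by
  induction F using Multiset.induction_on with
  | empty => simp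
  | cons f F ih =>
    filter_upwards [eventually_mem_ball_iff (hF f (Multiset.mem_cons_self f F)).continuousAt z₀,
      ih fun g hg => hF g (Multiset.mem_cons_of_mem hg)] with r h1 h2
    filter_upwards [h1, h2] with τ h1 h2 g hg
    rcases Multiset.mem_cons.1 hg with rfl | hg
    · exact h1
    · exact h2 g hg

theorem eventually_forall_mem_Ioo {p : ℝ → Prop} (h : ∀ᶠ s in 𝓝 0, p s) :
    ∀ᶠ ε : ℝ in 𝓝[>] 0, ∀ s ∈ Set.Ioo (-ε) ε, p s := by
  obtain ⟨δ, hδ, hp⟩ := Metric.eventually_nhds_iff.1 h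
  filter_upwards [Ioo_mem_nhdsGT hδ] with ε hε s hs
  refine hp ?_
  rw [Real.dist_eq, sub_zero]
  exact (abs_lt.2 hs).trans hε.2

/-- The regularity and the second-order expansion of one eigenvalue branch. -/
theorem branch_expansion {f g : ℂ → ℂ} {z₀ : ℂ} {α : ℝ} {q : ℕ} (hq : 0 < q) {ζ : ℂ}
    (hζ : ζ ^ q = -1) (hg : AnalyticAt ℂ g 0)
    (hfg : ∀ᶠ τ in 𝓝 0, f τ = z₀ + Complex.I * (α : ℝ) * τ ^ q + (τ ^ q) ^ 2 * g τ) :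
    (∀ᶠ ε : ℝ in 𝓝[>] 0, ContDiffOn ℝ 2 (fun s => f (signedRoot q ζ s)) (Set.Ioo (-ε) ε)) ∧
      (fun s : ℝ => f (signedRoot q ζ s) - (z₀ + Complex.I * α * s + g 0 * (s : ℂ) ^ 2))
        =o[𝓝 0] (fun s : ℝ => s ^ 2) := by
  have hroot := tendsto_signedRoot_zero hq hζ
  have heq : ∀ᶠ s : ℝ in 𝓝 0, f (signedRoot q ζ s)
      = z₀ + Complex.I * (α : ℝ) * s + (s : ℂ) ^ 2 * g (signedRoot q ζ s) := by
    filter_upwards [hroot.eventually hfg] with s hs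
    rw [hs, signedRoot_pow hq hζ]
  constructor
  · filter_upwards [eventually_forall_mem_Ioo heq,
      exists_contDiffOn_sq_mul_comp_signedRoot hq hζ hg] with ε h1 h2
    have hlin : ContDiff ℝ 2 (fun s : ℝ => z₀ + Complex.I * (α : ℝ) * s) :=
      contDiff_const.add (contDiff_const.mul Complex.ofRealCLM.contDiff)
    exact (hlin.contDiffOn.add h2).congr h1
  · have h1 : (fun s : ℝ => g (signedRoot q ζ s) - g 0) =o[𝓝 0] (fun _ : ℝ => (1 : ℝ)) := by
      rw [isLittleO_one_iff, tendsto_sub_nhds_zero_iff]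
      exact hg.continuousAt.tendsto.comp hroot
    have h2 : (fun s : ℝ => (s : ℂ) ^ 2) =O[𝓝 0] (fun s : ℝ => s ^ 2) :=
      isBigO_of_le _ fun s => by simp
    have h3 := h2.mul_isLittleO h1
    simp only [mul_one] at h3
    refine h3.congr' (heq.mono fun s hs => ?_) EventuallyEq.rfl
    simp only
    rw [hs]
    ring

theorem re_le_zero_of_hasEigenvalue {E : Type*} [NormedAddCommGroup E] [NormedSpace ℂ E]
    {f : E →L[ℂ] E} {C : ℝ} (hC : ∀ z : ℂ, 0 < z.re → ∀ x, z.re * ‖x‖ ≤ C * ‖z • x - f x‖) {z : ℂ}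
    (hz : Module.End.HasEigenvalue f.toLinearMap z) : z.re ≤ 0 := by
  by_contra! h
  obtain ⟨x, hx⟩ := hz.exists_hasEigenvector
  have h1 : f x = z • x := hx.apply_eq_smul
  have h2 := hC z h x
  rw [h1, sub_self, norm_zero, mul_zero] at h2
  exact (mul_pos h (norm_pos_iff.2 hx.2)).not_ge h2

open Classical Polynomial in
/-- The eigenvalues splitting from an imaginary eigenvalue of an analytic family of operators with
uniform one-sided resolvent bounds are twice continuously differentiable, move along the imaginary
axis to first order and to the left to second order. -/
theorem exists_eigenvalue_branches {E : Type*} [NormedAddCommGroup E] [NormedSpace ℂ E]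
    [FiniteDimensional ℂ E] {A : ℝ → E →L[ℂ] E} (hA : AnalyticAt ℝ A 0) {C : ℝ}
    (hC : ∀ (s : ℝ) (z : ℂ), 0 < z.re → ∀ x, z.re * ‖x‖ ≤ C * ‖z • x - A s x‖) (ω : ℝ) :
    ∃ (ev : Fin (Module.finrank ℂ
          (Module.End.eigenspace (A 0).toLinearMap (Complex.I * ω))) → ℝ → ℂ)
      (r ε : ℝ), 0 < r ∧ 0 < ε ∧
      (∀ s ∈ Set.Ioo (-ε) ε,
        (A s).toLinearMap.charpoly.roots.filter (fun z => z ∈ Metric.ball (Complex.I * ω) r)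
          = Finset.univ.val.map (fun j => ev j s)) ∧
      ∀ j, ContDiffOn ℝ 2 (ev j) (Set.Ioo (-ε) ε) ∧
        ∃ (l₁ : ℝ) (l₂ : ℂ), l₂.re ≤ 0 ∧
          (fun s : ℝ => ev j s - (Complex.I * ω + Complex.I * l₁ * s + l₂ * (s : ℂ) ^ 2))
            =o[𝓝 0] (fun s : ℝ => s ^ 2) := by
  set z₀ : ℂ := Complex.I * ω with hz₀
  have : CompleteSpace E := FiniteDimensional.complete ℂ E
  obtain ⟨D, hD⟩ := hA.exists_isBigO_sq
  obtain ⟨S, K, r₀, hr₀, hincl⟩ := exists_norm_eigenvalue_sub_le_sq hC hD ω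
  obtain ⟨A', hA', hAA'⟩ := hA.exists_complex_extension
  obtain ⟨q, hq, F, hF, hroots⟩ := (isMonicAnalytic_charpoly hA').hasPuiseuxRoots
  have hroots' : ∀ᶠ τ in 𝓝 (0 : ℂ), (A' (τ ^ q)).toLinearMap.charpoly.roots
      = F.map fun f => f τ := hroots.mono fun τ hτ => by
    have h1 := roots_multiset_prod_X_sub_C (F.map fun f => f τ)
    rw [Multiset.map_map] at h1
    exact (congrArg roots hτ).trans h1
  have hA0 : A' 0 = A 0 := by simpa using hAA'.self_of_nhds
  obtain ⟨ζ, hζ⟩ : ∃ ζ : ℂ, ζ ^ q = -1 := IsAlgClosed.exists_pow_nat_eq (-1) hq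
  -- The number of branches through `z₀` is its algebraic multiplicity, equal to the dimension of
  -- the eigenspace because there is no Jordan block.
  have hcard : (F.filter fun f => f 0 = z₀).card
      = Module.finrank ℂ (Module.End.eigenspace (A 0).toLinearMap z₀) := by
    rw [← maxGenEigenspace_eq_eigenspace_of_resolvent_bound (C := C)
      (fun h hh x => by
        have := hC 0 (z₀ + h) (by simpa [hz₀] using hh) x
        simpa [hz₀] using this), LinearMap.finrank_maxGenEigenspace_eq, ← count_roots]
    have h0 := hroots'.self_of_nhds
    rw [zero_pow hq.ne', hA0] at h0
    rw [h0, Multiset.count_map]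
    simp only [eq_comm]
  obtain ⟨φ, hφ⟩ := exists_fin_enumeration _ hcard
  have hφmem : ∀ j, φ j ∈ F ∧ φ j 0 = z₀ := fun j => by
    have h1 : φ j ∈ F.filter fun f => f 0 = z₀ := by
      rw [← hφ]; exact Multiset.mem_map_of_mem _ (Finset.mem_univ j)
    exact Multiset.mem_filter.1 h1
  have hpow : Tendsto (fun t : ℝ => t ^ q) (𝓝[>] 0) (𝓝 0) := by
    have := (continuous_pow (M := ℝ) q).tendsto 0
    rw [zero_pow hq.ne'] at this
    exact this.mono_left nhdsWithin_le_nhds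
  have hofReal : Tendsto (fun t : ℝ => (t : ℂ)) (𝓝[>] 0) (𝓝 0) := by
    have : Tendsto (fun s : ℝ => (s : ℂ)) (𝓝 0) (𝓝 0) := by
      simpa using Complex.continuous_ofReal.tendsto 0
    exact this.mono_left nhdsWithin_le_nhds
  have heig : ∀ᶠ t : ℝ in 𝓝[>] 0, ∀ f ∈ F,
      Module.End.HasEigenvalue (A (t ^ q)).toLinearMap (f t) := by
    filter_upwards [hpow.eventually hAA', hofReal.eventually hroots'] with t h1 h2 f hf
    rw [Module.End.hasEigenvalue_iff_isRoot_charpoly,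
      ← mem_roots (LinearMap.charpoly_monic _).ne_zero, ← h1, Complex.ofReal_pow, h2]
    exact Multiset.mem_map_of_mem _ hf
  -- Only `τ = t > 0` is tested, where `t ^ q` is a genuine real parameter. Analyticity extends the
  -- resulting factorization to all small complex `τ`, hence to the roots of negative `s`.
  have hbranch : ∀ j, ∃ (α : ℝ) (g : ℂ → ℂ), AnalyticAt ℂ g 0 ∧ (g 0).re ≤ 0 ∧
      ∀ᶠ τ in 𝓝 0, φ j τ = z₀ + Complex.I * (α : ℝ) * τ ^ q + (τ ^ q) ^ 2 * g τ := by
    intro j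
    obtain ⟨hjF, hj0⟩ := hφmem j
    have hjan := hF _ hjF
    have hnear : ∀ᶠ t : ℝ in 𝓝[>] 0, ‖φ j t - z₀‖ < r₀ := by
      have h1 : Tendsto (fun t : ℝ => ‖φ j t - z₀‖) (𝓝[>] 0) (𝓝 ‖φ j 0 - z₀‖) :=
        ((hjan.continuousAt.tendsto.comp hofReal).sub_const z₀).norm
      rw [hj0, sub_self, norm_zero] at h1
      exact h1.eventually_lt_const hr₀
    obtain ⟨α, -, g, hg, hfg⟩ := hjan.exists_eq_add_pow_mul (z₀ := z₀) (q := q) (S := S) (K := K)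
      (by
        filter_upwards [heig, hnear, hpow.eventually hincl] with t h1 h2 h3
        exact h3 (φ j t - z₀) h2 (by rw [← hz₀, add_sub_cancel]; exact h1 _ hjF))
    refine ⟨α, g, hg, ?_, hfg⟩
    have hgt : Tendsto (fun t : ℝ => (g t).re) (𝓝[>] 0) (𝓝 (g 0).re) :=
      (Complex.continuous_re.tendsto _).comp (hg.continuousAt.tendsto.comp hofReal)
    refine le_of_tendsto hgt ?_
    -- The constant and linear terms are imaginary, so `Re (φ j t) = (t ^ q) ^ 2 * Re (g t)`, which
    -- is nonpositive since `φ j t` is an eigenvalue.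
    filter_upwards [heig, hofReal.eventually hfg, self_mem_nhdsWithin] with t h1 h2 (ht : 0 < t)
    have h3 := re_le_zero_of_hasEigenvalue (hC _) (h1 _ hjF)
    have h4 : (φ j t).re = (t ^ q) ^ 2 * (g t).re := by
      have e : z₀ + Complex.I * (α : ℝ) * (t : ℂ) ^ q + ((t : ℂ) ^ q) ^ 2 * g t
          = Complex.I * ((ω + α * t ^ q : ℝ) : ℂ) + (((t ^ q) ^ 2 : ℝ) : ℂ) * g t := by
        rw [hz₀]; push_cast; ring
      rw [h2, e, Complex.add_re, Complex.re_ofReal_mul, Complex.I_mul_re, Complex.ofReal_im,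
        neg_zero, zero_add]
    rw [h4] at h3
    have h5 : 0 < (t ^ q) ^ 2 := by positivity
    by_contra! h6
    exact (mul_pos h5 h6).not_ge h3
  choose α g hg hgre hfg using hbranch
  have hexp := fun j => branch_expansion hq hζ (hg j) (hfg j)
  obtain ⟨r, hball, hr : 0 < r⟩ :=
    ((eventually_forall_mem_ball_iff hF z₀).and self_mem_nhdsWithin).exists
  have hroot := tendsto_signedRoot_zero hq hζ
  have hev : ∀ᶠ s : ℝ in 𝓝 0,
      (A s).toLinearMap.charpoly.roots.filter (fun z => z ∈ Metric.ball z₀ r)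
        = Finset.univ.val.map (fun j => φ j (signedRoot q ζ s)) := by
    filter_upwards [hAA', hroot.eventually hroots', hroot.eventually hball] with s h1 h2 h3
    rw [signedRoot_pow hq hζ] at h2
    rw [← h1, h2, Multiset.filter_map]
    have h4 : F.filter ((fun z => z ∈ Metric.ball z₀ r) ∘ fun f => f (signedRoot q ζ s))
        = F.filter fun f => f 0 = z₀ := Multiset.filter_congr fun f hf => h3 f hf
    rw [h4, ← hφ, Multiset.map_map]
    rfl
  obtain ⟨ε, ⟨h1, h2⟩, hε : 0 < ε⟩ := (((eventually_forall_mem_Ioo hev).and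
    (eventually_all.2 fun j => (hexp j).1)).and self_mem_nhdsWithin).exists
  exact ⟨fun j s => φ j (signedRoot q ζ s), r, ε, hr, hε, h1,
    fun j => ⟨h2 j, α j, g j 0, hgre j, (hexp j).2⟩⟩

end Branches

theorem corollary5 {V : Type*} [NormedAddCommGroup V] [InnerProductSpace ℂ V] [CompleteSpace V]
    [FiniteDimensional ℂ V] {ι : Type*} [Fintype ι]
    (H : ℝ → Op V) (L : ℝ → ι → Op V)
    (H₀ H₁ : Op V) (L₀ : ι → Op V)
    -- the Hamiltonians are Hermitian
    (hH_self : ∀ s, IsSelfAdjoint (H s))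
    -- the perturbed Liouvillian is analytic in the real parameter `s` at `s = 0`
    (h_analytic : AnalyticAt ℝ (fun s : ℝ => liouvillian (H s) (L s)) 0)
    -- `H(s) = H₀ + s H₁ + O(s²)` and `L_μ(s) = L₀_μ + O(s²)` for all `μ`
    (hH : (fun s : ℝ => H s - (H₀ + s • H₁)) =O[𝓝 0] (fun s : ℝ => s ^ 2))
    (hL : ∀ μ, (fun s : ℝ => L s μ - L₀ μ) =O[𝓝 0] (fun s : ℝ => s ^ 2))
    -- `i ω` is an eigenvalue of the unperturbed Liouvillian
    (ω : ℝ)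
    (hω : Module.End.HasEigenvalue (liouvillian H₀ L₀).toLinearMap (Complex.I * ω)) :
    -- the first-order term of the Liouvillian is `-i [H₁, ·]`
    HasDerivAt (fun s : ℝ => liouvillian (H s) (L s)) (unitaryGenerator H₁) 0 ∧
    -- the eigenvalues that split from `i ω`, one for each dimension of its eigenspace
    ∃ (ev : Fin (Module.finrank ℂ
          (Module.End.eigenspace (liouvillian H₀ L₀).toLinearMap (Complex.I * ω))) → ℝ → ℂ)
      (r ε : ℝ), 0 < r ∧ 0 < ε ∧
      -- for small `s` they are all the eigenvalues near `i ω`, with multiplicity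
      (∀ s ∈ Set.Ioo (-ε) ε,
        eigenvaluesNear (liouvillian (H s) (L s)) (Complex.I * ω) r
          = Finset.univ.val.map (fun j => ev j s)) ∧
      ∀ j,
        -- each is twice continuously differentiable
        ContDiffOn ℝ 2 (ev j) (Set.Ioo (-ε) ε) ∧
        -- and has the second-order expansion, i.e. the exponent `1 + 1/p` with `p = 1`
        ∃ (l₁ : ℝ) (l₂ : ℂ), l₂.re ≤ 0 ∧
          (fun s : ℝ => ev j s - (Complex.I * ω + Complex.I * l₁ * s + l₂ * (s : ℂ) ^ 2))
            =o[𝓝 0] (fun s : ℝ => s ^ 2) := by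
  obtain ⟨hH0, hHd⟩ := eq_and_hasDerivAt_of_isBigO_sq hH
  have hL' : ∀ μ, L 0 μ = L₀ μ ∧ HasDerivAt (fun s => L s μ) 0 0 := fun μ =>
    eq_and_hasDerivAt_of_isBigO_sq (a := L₀ μ) (b := 0) (by simpa using hL μ)
  have hL0 : L 0 = L₀ := funext fun μ => (hL' μ).1
  subst hH0 hL0
  obtain ⟨C, hC⟩ := exists_forall_re_mul_norm_le_norm_smul_sub_liouvillian V (ι := ι)
  exact ⟨hasDerivAt_liouvillian hHd fun μ => (hL' μ).2,
    exists_eigenvalue_branches h_analytic (fun s z hz x => hC (H s) (hH_self s) (L s) z hz x) ω⟩
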